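/- **Theorem 1.2 (Blow up in the subcritical case).** Let $N\ge 1$, $0<\sigma<2$, $-1\le\beta\le 1$, $p_c=1+\frac{\sigma}{N}$ and $1<p<p_c$. Let $b:[0,\infty)\to(0,\infty)$ be differentiable with, for some $b_1,b_2,b_3>0$ and all $t\ge0$, $$b_1(1+t)^{-\beta}\le b(t)\le b_2(1+t)^{-\beta},\qquad |b'(t)|\le b_3(1+t)^{-1}b(t).$$ Let $f:\mathbb R\to\mathbb R$ satisfy $f(0)=0$, $|f(z)-f(w)|\le C_0(|z|^{p-1}+|w|^{p-1})|z-w|$ for all $z,w\in\mathbb R$ and some constant $C_0$, and $f(z)\ge C_1|z|^p$ for all $z\in\mathbb R$ and some constant $C_1>0$. Consider $$\partial_t^2u+(-\Delta)^{\sigma/2}u+b(t)\,\partial_tu=f(u)\ \text{ on }[0,T)\times\mathbb R^N,\qquad u(0)=\epsilon a_0,\quad \partial_tu(0)=\epsilon a_1, \tag{1}$$ where $(-\Delta)^{\sigma/2}g=\mathcal F^{-1}[|\xi|^\sigma\mathcal F g]$. A strong solution on $[0,T)$ is a real-valued $u\in C^2([0,T);L^2(\mathbb R^N))\cap C^1([0,T);H^{\sigma/2}(\mathbb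 R^N))\cap C([0,T);H^\sigma(\mathbb R^N))$ satisfying the initial conditions and, for every $t\in[0,T)$, the equation as an identity in $L^2(\mathbb R^N)$. The lifespan $T_0=T_0(\epsilon)\in[0,\infty]$ is the supremum of all $T>0$ for which a strong solution on $[0,T)$ exists. Let $a_0\in H^{\sigma/2}(\mathbb R^N)\cap L^1(\mathbb R^N)$ and $a_1\in L^2(\mathbb R^N)\cap L^1(\mathbb R^N)$ be real-valued with $$I_0:=\int_{\mathbb R^N}a_0\,dx>0,\qquad I_1:=\int_{\mathbb R^N}a_1\,dx>0.$$ Fix $q$ with $N<q<N+p\sigma$, write $p'=\frac{p}{p-1}$ and $\langle x\rangle=(1+|x|^2)^{1/2}$, and put $$A=\Big(\frac2{C_1}\Big)^{p'-1}(p')^{-\frac1p}\,p^{\frac{1-p'}p}\,\big\|\langle x\rangle^{\frac qp}(-\Delta)^{\frac\sigma2}\langle x\rangle^{-q}\big\|_{L^{p'}}^{p'/p}\,\big\|\langle x\rangle^{-q}\big\|_{L^1}^{1/p'},\qquad R(\epsilon)=A^{-\frac{p-1}{N(p-p_c)}}\Big(\frac\epsilon4I_0\Big)^{\frac{p-1}{N(p-p_c)}}.$$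 Let $\epsilon_0>0$ be such that for every $0<\epsilon\le\epsilon_0$ $$\int_{\mathbb R^N}\Big\langle\frac{x}{R(\epsilon)}\Big\rangle^{-q}a_0(x)\,dx\ge\tfrac12I_0,\tag{BLC1}$$ $$\int_{\mathbb R^N}\Big\langle\frac{x}{R(\epsilon)}\Big\rangle^{-q}a_1(x)\,dx\ge\tfrac12I_1,\tag{BLC2}$$ $$\epsilon I_0\le\Big(\frac{C_1}2\Big)^{-\frac1{p-1}}\big\|\langle x\rangle^{-q}\big\|_{L^1(\mathbb R^N)}R(\epsilon)^N.\tag{BLC3}$$ Then there is a constant $C>0$, independent of $\epsilon$, such that for all $0<\epsilon\le\epsilon_0$ the lifespan of the strong solution of (1) satisfies $$T_0\le\begin{cases}C\,\epsilon^{-\frac{1}{\left(\frac1{p-1}-\frac N\sigma\right)(1+\beta)}},&-1<\beta\le1,\\[1ex]\exp\Big(C\,\epsilon^{-\frac1{\frac1{p-1}-\frac N\sigma}}\Big),&\beta=-1.\end{cases}$$ -/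

import Mathlib

open MeasureTheory Set FourierTransform
open scoped ENNReal

noncomputable section

/-- The Euclidean space `ℝ^N`. -/
abbrev Space (N : ℕ) : Type := EuclideanSpace ℝ (Fin N)

/-- The Japanese bracket `⟨x⟩ = (1 + |x|²)^{1/2}`. -/
def japaneseBracket {N : ℕ} (x : Space N) : ℝ := Real.sqrt (1 + ‖x‖ ^ 2)

/-- The Fourier transform of a function in `L²(ℝ^N)` (Plancherel extension; Mathlib's
normalization `∫ g(x) e^{-2πi x·ξ} dx`). The value is `0` when the function is not in `L²`. -/
def l2Fourier {N : ℕ} (g : Space N → ℂ) : Space N → ℂ :=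
  open scoped Classical in
  if h : MemLp g 2 volume then
    ((𝓕 (h.toLp g) : Lp ℂ 2 (volume : Measure (Space N))) : Space N → ℂ)
  else 0

/-- The inverse of `l2Fourier` on `L²(ℝ^N)`. -/
def l2FourierInv {N : ℕ} (g : Space N → ℂ) : Space N → ℂ :=
  open scoped Classical in
  if h : MemLp g 2 volume then
    ((𝓕⁻ (h.toLp g) : Lp ℂ 2 (volume : Measure (Space N))) : Space N → ℂ)
  else 0

/-- The fractional Laplacian `(-Δ)^{σ/2} g = 𝓕⁻¹[|ξ|^σ 𝓕 g]` for `g ∈ H^σ(ℝ^N)`. With the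
`2π`-normalization of the Fourier transform, `|ξ|` becomes `2π|ξ|`. -/
def fracLaplacian {N : ℕ} (σ : ℝ) (g : Space N → ℂ) : Space N → ℂ :=
  l2FourierInv fun ξ => (((2 * Real.pi * ‖ξ‖) ^ σ : ℝ) : ℂ) * l2Fourier g ξ

/-- `g ∈ H^s(ℝ^N)` for `s ≥ 0`: `g ∈ L²` and `⟨ξ⟩^s ĝ ∈ L²`. -/
def MemHs {N : ℕ} (s : ℝ) (g : Space N → ℝ) : Prop :=
  MemLp g 2 volume ∧
    MemLp (fun ξ : Space N => ((japaneseBracket ((2 * Real.pi) • ξ) ^ s : ℝ) : ℂ) *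
      l2Fourier (fun x => (g x : ℂ)) ξ) 2 volume

/-- `u ∈ C^k([0,T); H^s(ℝ^N))` for `s ≥ 0`: for each `t ∈ [0,T)`, `⟨ξ⟩^s û(t) ∈ L²`, and these
functions form a `C^k` curve in `L²` (one-sided derivatives at `0`). By Plancherel,
`g ↦ ⟨ξ⟩^s ĝ` is an isometry of `H^s` into `L²`. -/
def IsCkHs {N : ℕ} (k : ℕ) (s T : ℝ) (u : ℝ → Lp ℝ 2 (volume : Measure (Space N))) : Prop :=
  ∃ v : ℝ → Lp ℂ 2 (volume : Measure (Space N)),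
    ContDiffOn ℝ k v (Ico 0 T) ∧
    ∀ t ∈ Ico 0 T, (v t : Space N → ℂ) =ᵐ[volume]
      fun ξ => ((japaneseBracket ((2 * Real.pi) • ξ) ^ s : ℝ) : ℂ) *
        l2Fourier (fun x => ((u t x : ℝ) : ℂ)) ξ

/-- The damping coefficient `b : [0,∞) → (0,∞)` satisfies
`b₁ (1+t)^{-β} ≤ b(t) ≤ b₂ (1+t)^{-β}` and `|b'(t)| ≤ b₃ (1+t)^{-1} b(t)`. -/
def IsDampingCoefficient (β : ℝ) (b : ℝ → ℝ) : Prop :=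
  DifferentiableOn ℝ b (Ici 0) ∧
  ∃ b₁ b₂ b₃ : ℝ, 0 < b₁ ∧ 0 < b₂ ∧ 0 < b₃ ∧
    ∀ t : ℝ, 0 ≤ t →
      0 < b t ∧ b₁ * (1 + t) ^ (-β) ≤ b t ∧ b t ≤ b₂ * (1 + t) ^ (-β) ∧
      |derivWithin b (Ici 0) t| ≤ b₃ * (1 + t)⁻¹ * b t

/-- `f(0) = 0` and `|f(z) - f(w)| ≤ C₀ (|z|^{p-1} + |w|^{p-1}) |z - w|` for some `C₀`. -/
def IsPowerNonlinearity (p : ℝ) (f : ℝ → ℝ) : Prop :=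
  f 0 = 0 ∧ ∃ C₀ : ℝ, ∀ z w : ℝ,
    |f z - f w| ≤ C₀ * (|z| ^ (p - 1) + |w| ^ (p - 1)) * |z - w|

/-- `u` is a strong solution on `[0,T)` of
`∂ₜ²u + (-Δ)^{σ/2} u + b(t) ∂ₜu = f(u)`, `u(0) = u₀`, `∂ₜu(0) = u₁`. The equation is an equality
in `L²(ℝ^N)` for each `t ∈ [0,T)`. -/
structure IsStrongSolution {N : ℕ} (σ : ℝ) (b f : ℝ → ℝ) (u₀ u₁ : Space N → ℝ) (T : ℝ)
    (u : ℝ → Lp ℝ 2 (volume : Measure (Space N))) : Prop where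
  contDiff_L2 : ContDiffOn ℝ 2 u (Ico 0 T)
  c1_Hs : IsCkHs 1 (σ / 2) T u
  c0_Hs : IsCkHs 0 σ T u
  initial_value : (u 0 : Space N → ℝ) =ᵐ[volume] u₀
  initial_velocity : ((derivWithin u (Ico 0 T) 0 : Lp ℝ 2 (volume : Measure (Space N))) : Space N → ℝ) =ᵐ[volume] u₁
  equation : ∀ t ∈ Ico 0 T, ∀ᵐ x : Space N,
    ((iteratedDerivWithin 2 u (Ico 0 T) t x : ℝ) : ℂ)
      + fracLaplacian σ (fun y => ((u t y : ℝ) : ℂ)) x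
      + ((b t * derivWithin u (Ico 0 T) t x : ℝ) : ℂ)
      = ((f (u t x) : ℝ) : ℂ)

/-- The lifespan: the supremum in `[0,∞]` of all `T > 0` such that a strong solution exists on
`[0,T)`. (A global solution restricts to every `[0,T)`, giving the value `∞`.) -/
def lifespan {N : ℕ} (σ : ℝ) (b f : ℝ → ℝ) (u₀ u₁ : Space N → ℝ) : ℝ≥0∞ :=
  sSup {τ : ℝ≥0∞ | ∃ T : ℝ, 0 < T ∧ τ = ENNReal.ofReal T ∧
    ∃ u : ℝ → Lp ℝ 2 (volume : Measure (Space N)), IsStrongSolution σ b f u₀ u₁ T u}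

/-- `p_c = 1 + σ/N`. -/
def critExponent (N : ℕ) (σ : ℝ) : ℝ := 1 + σ / N

/-- `‖⟨x⟩^{-q}‖_{L¹(ℝ^N)}`. -/
def weightL1 (N : ℕ) (q : ℝ) : ℝ := ∫ x : Space N, japaneseBracket x ^ (-q)

/-- With `p' = p/(p-1)`, the constant
`A = (2/C₁)^{p'-1} (p')^{-1/p} p^{(1-p')/p}
  ‖(-Δ)^{σ/2}⟨x⟩^{-q} · ⟨x⟩^{q/p}‖_{L^{p'}}^{p'/p} ‖⟨x⟩^{-q}‖_{L¹}^{1/p'}`. -/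
def constA (N : ℕ) (p σ q C₁ : ℝ) : ℝ :=
  let p' := p / (p - 1)
  (2 / C₁) ^ (p' - 1) * p' ^ (-1 / p) * p ^ ((1 - p') / p) *
    (eLpNorm (fun x : Space N =>
        fracLaplacian σ (fun y : Space N => ((japaneseBracket y ^ (-q) : ℝ) : ℂ)) x *
          ((japaneseBracket x ^ (q / p) : ℝ) : ℂ))
      (ENNReal.ofReal p') volume).toReal ^ (p' / p) *
    weightL1 N q ^ (1 / p')

/-- `R(ε) = A^{-(p-1)/(N(p-p_c))} (ε I₀ / 4)^{(p-1)/(N(p-p_c))}`. -/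
def radius (N : ℕ) (p σ q C₁ I₀ ε : ℝ) : ℝ :=
  constA N p σ q C₁ ^ (-((p - 1) / (N * (p - critExponent N σ)))) *
    (ε / 4 * I₀) ^ ((p - 1) / (N * (p - critExponent N σ)))

/-- The weighted average `∫ ⟨x/R⟩^{-q} a(x) dx`. -/
def weightedIntegral {N : ℕ} (q R : ℝ) (a : Space N → ℝ) : ℝ :=
  ∫ x : Space N, japaneseBracket (R⁻¹ • x) ^ (-q) * a x

/-- The three smallness conditions on `ε`, with `I₀ = ∫ a₀`, `I₁ = ∫ a₁` and `R = R(ε)`. -/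
structure SmallnessConditions {N : ℕ} (p σ q C₁ : ℝ) (a₀ a₁ : Space N → ℝ) (ε : ℝ) : Prop where
  average_a₀ : 1 / 2 * (∫ x, a₀ x) ≤
    weightedIntegral q (radius N p σ q C₁ (∫ x, a₀ x) ε) a₀
  average_a₁ : 1 / 2 * (∫ x, a₁ x) ≤
    weightedIntegral q (radius N p σ q C₁ (∫ x, a₀ x) ε) a₁
  small : ε * (∫ x, a₀ x) ≤
    (C₁ / 2) ^ (-1 / (p - 1)) * weightL1 N q * radius N p σ q C₁ (∫ x, a₀ x) ε ^ N

end

/-!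
The proof is the test function method with the non-compactly supported weight
`φ_R(x) = ⟨x/R⟩^{-q}`, followed by a blow-up argument for an ordinary differential inequality.

Let `M(t) = ∫ u(t) φ_R` be the weighted average of a strong solution. The fractional Laplacian is
symmetric, so testing the equation with `φ_R` gives
`M'' + b M' = ∫ f(u) φ_R - ∫ u (-Δ)^{σ/2} φ_R`. By Young's inequality the last integral is at most
`(C₁/2) ∫ |u|^p φ_R` plus a constant times the `p'`-th power of the norm of
`φ_R^{-1/p} (-Δ)^{σ/2} φ_R` in `L^{p'}`, which scales like `R^{N - σ p'}`. Hölder's inequality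
bounds `∫ |u|^p φ_R` from below by `|M|^p (R^N ‖⟨x⟩^{-q}‖_{L¹})^{-(p-1)}`. Hence
`M'' + b M' ≥ B (|M|^p - M_*^p)` with `B = (C₁/2) (R^N ‖⟨x⟩^{-q}‖_{L¹})^{-(p-1)}`
(`weighted_average_ineq`), and `A` is exactly the constant with `M_* = A R^{N - σ/(p-1)}`
(`young_error_eq`). At `R = R(ε)` the threshold `M_*` equals `ε I₀ / 4`, half of the lower bound
`ε I₀ / 2` for `M(0)`. So `y = M / (ε I₀ / 2)` satisfies `y'' + b y' ≥ lam y^p` as long as `y ≥ 1`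
(`IsStrongSolution.isDampedSupersolution`), where `lam` is a constant multiple of
`ε^{1/(1/(p-1) - N/σ)}` (`sourceStrength_eq`), and `y(0)` is bounded above, and `y'(0)` below,
independently of `ε`.

For this inequality, `y'` stays above `g y^{(p+1)/2}` for every `g` which starts low enough and is a
strict subsolution of the Riccati equation `g' + b g + (p+1)/2 g² = lam`
(`rpow_barrier_of_damped_ineq`); then `y` blows up before `∫ g` exceeds `2/(p-1)`
(`sub_le_of_rpow_growth`). While the damping dominates one can take `g` of size
`lam / b ~ lam (1+t)^β`, so that the blow-up time satisfies `T^{1+β} ≲ 1/lam`, or `log T ≲ 1/lam`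
for `β = -1`. For `β > 0` this `g` grows, and it is levelled off at the time `lam^{-1/(1+β)}`, where
its size is `lam^{1/(1+β)}`; then `g² ≲ lam` because `β ≤ 1` and `lam ≤ 1`. The latter is the third
smallness condition (`sourceStrength_le_one`). The three ranges of `β` are combined in
`exists_lifespan_bound`.

No decay estimate for `(-Δ)^{σ/2} ⟨x⟩^{-q}` has to be proved: the third smallness condition
implies `R(ε) > 0`, hence `A > 0`, and this contains the finiteness of the weighted norm.
-/

/-! ### Dilations in `L^p` -/

theorem ae_comp_smul {N : ℕ} {c : ℝ} (hc : c ≠ 0) {P : Space N → Prop}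
    (h : ∀ᵐ x : Space N, P x) : ∀ᵐ x : Space N, P (c • x) :=
  (Measure.quasiMeasurePreserving_smul (volume : Measure (Space N)) hc).ae h

theorem MeasureTheory.MemLp.comp_space_smul {N : ℕ} {F : Type*} [NormedAddCommGroup F]
    {g : Space N → F} {p : ℝ≥0∞} (hg : MemLp g p volume) {c : ℝ} (hc : c ≠ 0) :
    MemLp (fun x => g (c • x)) p volume := by
  refine MemLp.comp_of_map (f := fun x : Space N => c • x) (g := g) ?_ (by fun_prop)
  rw [Measure.map_addHaar_smul _ hc]
  exact hg.smul_measure ENNReal.ofReal_ne_top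

/-! ### The Fourier transform of square integrable functions -/

theorem l2Fourier_of_memLp {N : ℕ} {g : Space N → ℂ} (h : MemLp g 2 volume) :
    l2Fourier g = ((𝓕 (h.toLp g) : Lp ℂ 2 (volume : Measure (Space N))) : Space N → ℂ) := by
  simp only [l2Fourier, dif_pos h]

theorem l2FourierInv_of_memLp {N : ℕ} {g : Space N → ℂ} (h : MemLp g 2 volume) :
    l2FourierInv g = ((𝓕⁻ (h.toLp g) : Lp ℂ 2 (volume : Measure (Space N))) : Space N → ℂ) := by
  simp only [l2FourierInv, dif_pos h]

theorem memLp_l2Fourier {N : ℕ} (g : Space N → ℂ) : MemLp (l2Fourier g) 2 volume := by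
  by_cases h : MemLp g 2 volume
  · rw [l2Fourier_of_memLp h]; exact Lp.memLp _
  · simp only [l2Fourier, dif_neg h]; exact MemLp.zero

theorem memLp_l2FourierInv {N : ℕ} (g : Space N → ℂ) : MemLp (l2FourierInv g) 2 volume := by
  by_cases h : MemLp g 2 volume
  · rw [l2FourierInv_of_memLp h]; exact Lp.memLp _
  · simp only [l2FourierInv, dif_neg h]; exact MemLp.zero

theorem toLp_l2Fourier {N : ℕ} {g : Space N → ℂ} (h : MemLp g 2 volume) :
    (memLp_l2Fourier g).toLp (l2Fourier g) = 𝓕 (h.toLp g) := by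
  apply Lp.ext
  refine (MemLp.coeFn_toLp _).trans ?_
  rw [l2Fourier_of_memLp h]

theorem toLp_l2FourierInv {N : ℕ} {g : Space N → ℂ} (h : MemLp g 2 volume) :
    (memLp_l2FourierInv g).toLp (l2FourierInv g) = 𝓕⁻ (h.toLp g) := by
  apply Lp.ext
  refine (MemLp.coeFn_toLp _).trans ?_
  rw [l2FourierInv_of_memLp h]

theorem l2FourierInv_congr {N : ℕ} {g h : Space N → ℂ} (hgh : g =ᵐ[volume] h) :
    l2FourierInv g = l2FourierInv h := by
  by_cases hg : MemLp g 2 volume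
  · have hh : MemLp h 2 volume := hg.ae_eq hgh
    rw [l2FourierInv_of_memLp hg, l2FourierInv_of_memLp hh,
      (MemLp.toLp_eq_toLp_iff hg hh).2 hgh]
  · have hh : ¬ MemLp h 2 volume := fun hh => hg (hh.ae_eq hgh.symm)
    simp only [l2FourierInv, dif_neg hg, dif_neg hh]

theorem l2FourierInv_l2Fourier {N : ℕ} {g : Space N → ℂ} (h : MemLp g 2 volume) :
    l2FourierInv (l2Fourier g) =ᵐ[volume] g := by
  rw [l2FourierInv_of_memLp (memLp_l2Fourier g), toLp_l2Fourier h, fourierInv_fourier_eq]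
  exact MemLp.coeFn_toLp h

theorem l2Fourier_l2FourierInv {N : ℕ} {g : Space N → ℂ} (h : MemLp g 2 volume) :
    l2Fourier (l2FourierInv g) =ᵐ[volume] g := by
  rw [l2Fourier_of_memLp (memLp_l2FourierInv g), toLp_l2FourierInv h, fourier_fourierInv_eq]
  exact MemLp.coeFn_toLp h

/-- The multiplication formula: the Fourier transform is symmetric for the bilinear pairing. -/
theorem integral_schwartz_mul_l2Fourier {N : ℕ} {g : Space N → ℂ} (hg : MemLp g 2 volume)
    (ψ : SchwartzMap (Space N) ℂ) :
    ∫ ξ, ψ ξ * l2Fourier g ξ = ∫ x, (𝓕 ψ) x * g x := by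
  have h := congrArg (fun T => T ψ) (Lp.fourier_toTemperedDistribution_eq (hg.toLp g))
  simp only [TemperedDistribution.fourier_apply, Lp.toTemperedDistribution_apply,
    smul_eq_mul] at h
  rw [l2Fourier_of_memLp hg, ← h]
  refine integral_congr_ae ?_
  filter_upwards [hg.coeFn_toLp] with x hx
  rw [hx]

/-- The multiplication formula characterizes the Fourier transform on `L²`. -/
theorem l2Fourier_ae_eq_of_integral_schwartz {N : ℕ} {g h : Space N → ℂ}
    (hg : MemLp g 2 volume) (hh : MemLp h 2 volume)
    (H : ∀ ψ : SchwartzMap (Space N) ℂ, ∫ ξ, ψ ξ * h ξ = ∫ x, (𝓕 ψ) x * g x) :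
    l2Fourier g =ᵐ[volume] h := by
  have key : 𝓕 (hg.toLp g) = hh.toLp h := by
    have hinj := LinearMap.ker_eq_bot.1
      (Lp.ker_toTemperedDistributionCLM_eq_bot (E := Space N) (F := ℂ) (μ := volume) (p := 2))
    apply hinj
    simp only [ContinuousLinearMap.coe_coe, Lp.toTemperedDistributionCLM_apply]
    ext ψ
    simp only [Lp.toTemperedDistribution_apply, smul_eq_mul]
    rw [← l2Fourier_of_memLp hg, integral_schwartz_mul_l2Fourier hg, ← H]
    refine integral_congr_ae ?_
    filter_upwards [hh.coeFn_toLp] with x hx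
    rw [hx]
  rw [l2Fourier_of_memLp hg, key]
  exact hh.coeFn_toLp

theorem fourier_comp_inv_smul {N : ℕ} {R : ℝ} (hR : 0 < R) (ψ : Space N → ℂ) (x : Space N) :
    𝓕 (fun y => ψ (R⁻¹ • y)) x = (R : ℂ) ^ N * 𝓕 ψ (R • x) := by
  rw [Real.fourier_eq, Real.fourier_eq]
  have h := Measure.integral_comp_inv_smul_of_nonneg (volume : Measure (Space N))
    (fun v => Real.fourierChar (-inner ℝ v (R • x)) • ψ v) hR.le
  simp only [finrank_euclideanSpace, Fintype.card_fin] at h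
  rw [Complex.real_smul] at h
  push_cast at h
  rw [← h]
  congr 1
  ext v
  rw [real_inner_smul_left, real_inner_smul_right, inv_mul_cancel_left₀ hR.ne']

theorem l2Fourier_comp_inv_smul {N : ℕ} {g : Space N → ℂ} (hg : MemLp g 2 volume) {R : ℝ}
    (hR : 0 < R) :
    l2Fourier (fun x => g (R⁻¹ • x)) =ᵐ[volume] fun ξ => (R : ℂ) ^ N * l2Fourier g (R • ξ) := by
  refine l2Fourier_ae_eq_of_integral_schwartz (hg.comp_space_smul (inv_ne_zero hR.ne'))
    (((memLp_l2Fourier g).comp_space_smul hR.ne').const_mul _) fun ψ => ?_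
  have hRN : (R : ℂ) ^ N ≠ 0 := pow_ne_zero _ (by exact_mod_cast hR.ne')
  let e : Space N ≃L[ℝ] Space N :=
    ContinuousLinearEquiv.smulLeft (Units.mk0 R⁻¹ (inv_ne_zero hR.ne'))
  let ψ' : SchwartzMap (Space N) ℂ := SchwartzMap.compCLMOfContinuousLinearEquiv ℂ e ψ
  have hψ' : ∀ x, ψ' x = ψ (R⁻¹ • x) := fun x => rfl
  have hF : ∀ x, (𝓕 ψ') x = (R : ℂ) ^ N * (𝓕 ψ) (R • x) := fun x =>
    fourier_comp_inv_smul hR ψ x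
  have h1 := integral_schwartz_mul_l2Fourier hg ψ'
  have h2 := Measure.integral_comp_smul_of_nonneg (volume : Measure (Space N))
    (fun ξ => ψ' ξ * l2Fourier g ξ) R (hR := hR.le)
  have h3 := Measure.integral_comp_smul_of_nonneg (volume : Measure (Space N))
    (fun x => (𝓕 ψ) x * g (R⁻¹ • x)) R (hR := hR.le)
  simp only [finrank_euclideanSpace, Fintype.card_fin, Complex.real_smul, hψ', smul_smul,
    inv_mul_cancel₀ hR.ne', one_smul] at h2 h3
  push_cast at h2 h3
  have h4 : ∫ x, (𝓕 ψ') x * g x = (R : ℂ) ^ N * ∫ x, (𝓕 ψ) (R • x) * g x := by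
    rw [← integral_const_mul]
    congr 1; ext x; rw [hF]; ring
  have h5 : ∫ ξ, ψ ξ * ((R : ℂ) ^ N * l2Fourier g (R • ξ))
      = (R : ℂ) ^ N * ∫ ξ, ψ ξ * l2Fourier g (R • ξ) := by
    rw [← integral_const_mul]
    congr 1; ext x; ring
  simp only [hψ'] at h1
  rw [h5, h2, h1, h4, h3]
  field_simp

theorem l2FourierInv_comp_smul {N : ℕ} {h : Space N → ℂ} (hh : MemLp h 2 volume) {R : ℝ}
    (hR : 0 < R) :
    l2FourierInv (fun ξ => (R : ℂ) ^ N * h (R • ξ))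
      =ᵐ[volume] fun x => l2FourierInv h (R⁻¹ • x) := by
  have h1 := l2Fourier_comp_inv_smul (memLp_l2FourierInv h) hR
  have h2 := ae_comp_smul hR.ne' (l2Fourier_l2FourierInv hh)
  have h3 : l2Fourier (fun x => l2FourierInv h (R⁻¹ • x))
      =ᵐ[volume] fun ξ => (R : ℂ) ^ N * h (R • ξ) := by
    filter_upwards [h1, h2] with ξ h1 h2
    rw [h1, h2]
  rw [← l2FourierInv_congr h3]
  exact l2FourierInv_l2Fourier ((memLp_l2FourierInv h).comp_space_smul (inv_ne_zero hR.ne'))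

theorem l2FourierInv_const_mul {N : ℕ} {h : Space N → ℂ} (hh : MemLp h 2 volume) (c : ℂ) :
    l2FourierInv (fun ξ => c * h ξ) =ᵐ[volume] fun x => c * l2FourierInv h x := by
  rw [l2FourierInv_of_memLp (hh.const_mul c), l2FourierInv_of_memLp hh]
  have : (hh.const_mul c).toLp (fun ξ => c * h ξ) = c • hh.toLp h := rfl
  rw [this, FourierTransform.fourierInv_smul]
  exact Lp.coeFn_smul _ _

/-! ### The fractional Laplacian -/

theorem memLp_fracLaplacian {N : ℕ} (σ : ℝ) (g : Space N → ℂ) :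
    MemLp (fracLaplacian σ g) 2 volume := memLp_l2FourierInv _

/-- The fractional Laplacian is homogeneous of degree `σ` under dilations. -/
theorem fracLaplacian_comp_inv_smul {N : ℕ} {σ : ℝ} {g : Space N → ℂ} (hg : MemLp g 2 volume)
    (hm : MemLp (fun ξ => (((2 * Real.pi * ‖ξ‖) ^ σ : ℝ) : ℂ) * l2Fourier g ξ) 2 volume)
    {R : ℝ} (hR : 0 < R) :
    fracLaplacian σ (fun x => g (R⁻¹ • x))
      =ᵐ[volume] fun x => ((R ^ (-σ) : ℝ) : ℂ) * fracLaplacian σ g (R⁻¹ • x) := by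
  have h1 := l2Fourier_comp_inv_smul hg hR
  have hm' := hm.const_mul ((R ^ (-σ) : ℝ) : ℂ)
  have h2 : (fun ξ : Space N => (((2 * Real.pi * ‖ξ‖) ^ σ : ℝ) : ℂ) *
        l2Fourier (fun x => g (R⁻¹ • x)) ξ)
      =ᵐ[volume] fun ξ => (R : ℂ) ^ N * (((R ^ (-σ) : ℝ) : ℂ) *
        ((((2 * Real.pi * ‖R • ξ‖) ^ σ : ℝ) : ℂ) * l2Fourier g (R • ξ))) := by
    filter_upwards [h1] with ξ h1
    have : (2 * Real.pi * ‖R • ξ‖) ^ σ = R ^ σ * (2 * Real.pi * ‖ξ‖) ^ σ := by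
      rw [norm_smul, Real.norm_of_nonneg hR.le, ← Real.mul_rpow hR.le (by positivity)]
      congr 1; ring
    rw [h1, this, Real.rpow_neg hR.le]
    have hne : ((R ^ σ : ℝ) : ℂ) ≠ 0 := by exact_mod_cast (Real.rpow_pos_of_pos hR σ).ne'
    push_cast
    field_simp
  unfold fracLaplacian
  rw [l2FourierInv_congr h2]
  refine (l2FourierInv_comp_smul hm' hR).trans ?_
  exact ae_comp_smul (inv_ne_zero hR.ne') (l2FourierInv_const_mul hm _)

theorem inner_toLp_eq_integral {N : ℕ} {g h : Space N → ℂ} (hg : MemLp g 2 volume)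
    (hh : MemLp h 2 volume) :
    inner ℂ (hg.toLp g) (hh.toLp h) = ∫ x, inner ℂ (g x) (h x) := by
  rw [L2.inner_def]
  refine integral_congr_ae ?_
  filter_upwards [hg.coeFn_toLp, hh.coeFn_toLp] with x h1 h2
  rw [h1, h2]

/-- The fractional Laplacian is symmetric. -/
theorem integral_inner_fracLaplacian {N : ℕ} {σ : ℝ} {g h : Space N → ℂ}
    (hg : MemLp g 2 volume) (hh : MemLp h 2 volume)
    (hmg : MemLp (fun ξ => (((2 * Real.pi * ‖ξ‖) ^ σ : ℝ) : ℂ) * l2Fourier g ξ) 2 volume)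
    (hmh : MemLp (fun ξ => (((2 * Real.pi * ‖ξ‖) ^ σ : ℝ) : ℂ) * l2Fourier h ξ) 2 volume) :
    ∫ x, inner ℂ (fracLaplacian σ g x) (h x) = ∫ x, inner ℂ (g x) (fracLaplacian σ h x) := by
  rw [← inner_toLp_eq_integral (memLp_fracLaplacian σ g) hh,
    ← inner_toLp_eq_integral hg (memLp_fracLaplacian σ h)]
  have e1 : (memLp_fracLaplacian σ g).toLp (fracLaplacian σ g) = 𝓕⁻ (hmg.toLp _) :=
    toLp_l2FourierInv hmg
  have e2 : (memLp_fracLaplacian σ h).toLp (fracLaplacian σ h) = 𝓕⁻ (hmh.toLp _) :=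
    toLp_l2FourierInv hmh
  rw [e1, e2, ← Lp.inner_fourier_eq, ← Lp.inner_fourier_eq (hg.toLp g), fourier_fourierInv_eq,
    fourier_fourierInv_eq, ← toLp_l2Fourier hg, ← toLp_l2Fourier hh, inner_toLp_eq_integral,
    inner_toLp_eq_integral]
  congr 1
  ext ξ
  simp only [RCLike.inner_apply, map_mul, Complex.conj_ofReal]
  ring

theorem abs_integral_re_fracLaplacian_mul_le {N : ℕ} {σ : ℝ} {u φ : Space N → ℝ}
    (hu : MemLp u 2 volume) (hφ : MemLp φ 2 volume)
    (hmu : MemLp (fun ξ => (((2 * Real.pi * ‖ξ‖) ^ σ : ℝ) : ℂ) *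
      l2Fourier (fun x => (u x : ℂ)) ξ) 2 volume)
    (hmφ : MemLp (fun ξ => (((2 * Real.pi * ‖ξ‖) ^ σ : ℝ) : ℂ) *
      l2Fourier (fun x => (φ x : ℂ)) ξ) 2 volume) :
    |∫ x, (fracLaplacian σ (fun y => (u y : ℂ)) x).re * φ x|
      ≤ ∫ x, |u x| * ‖fracLaplacian σ (fun y => (φ y : ℂ)) x‖ := by
  have hint : Integrable (fun x => inner ℂ (fracLaplacian σ (fun y => (u y : ℂ)) x) (φ x : ℂ))
      volume := by
    have := L2.integrable_inner (𝕜 := ℂ) ((memLp_fracLaplacian σ (fun y => (u y : ℂ))).toLp _)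
      (hφ.ofReal (K := ℂ) |>.toLp _)
    refine this.congr ?_
    filter_upwards [(memLp_fracLaplacian σ (fun y => (u y : ℂ))).coeFn_toLp,
      (hφ.ofReal (K := ℂ)).coeFn_toLp] with x h1 h2
    rw [h1, h2]; rfl
  have h := integral_inner_fracLaplacian (hu.ofReal (K := ℂ)) (hφ.ofReal (K := ℂ)) hmu hmφ
  have h1 : ∫ x, (fracLaplacian σ (fun y => (u y : ℂ)) x).re * φ x
      = (∫ x, inner ℂ (fracLaplacian σ (fun y => (u y : ℂ)) x) (φ x : ℂ)).re := by
    have := integral_re hint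
    simp only [RCLike.re_eq_complex_re] at this
    rw [← this]
    congr 1; ext x
    simp [mul_comm]
  rw [h1]
  refine (Complex.abs_re_le_norm _).trans ?_
  refine (congrArg norm h).le.trans ?_
  refine (norm_integral_le_integral_norm _).trans (le_of_eq ?_)
  congr 1; ext x
  simp [mul_comm]

/-! ### Blow-up for a damped second order differential inequality -/

/-- A barrier argument: a solution of `y'' + b y' ≥ lam y^p` that starts above the curve
`y' = g y^r`, `r = (p+1)/2`, stays above it as long as `g` is a strict subsolution of the
Riccati equation `g' + b g + r g² = lam`. -/
theorem rpow_barrier_of_damped_ineq {p lam T : ℝ} (hp : 1 < p) {b g g' y y' y'' : ℝ → ℝ}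
    (hy : ∀ t ∈ Ico 0 T, HasDerivWithinAt y (y' t) (Ico 0 T) t)
    (hy' : ∀ t ∈ Ico 0 T, HasDerivWithinAt y' (y'' t) (Ico 0 T) t)
    (hg : ∀ t ∈ Ico 0 T, HasDerivWithinAt g (g' t) (Ico 0 T) t)
    (hg0 : ∀ t ∈ Ico 0 T, 0 ≤ g t) (hb : ∀ t ∈ Ico 0 T, 0 ≤ b t)
    (hode : ∀ t ∈ Ico 0 T, 1 ≤ y t → lam * y t ^ p ≤ y'' t + b t * y' t)
    (hric : ∀ t ∈ Ico 0 T, b t * g t + |g' t| + (p + 1) / 2 * g t ^ 2 < lam)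
    (h0 : 1 ≤ y 0) (h0' : g 0 * y 0 ^ ((p + 1) / 2) < y' 0) {t : ℝ} (ht : t ∈ Ico 0 T) :
    1 ≤ y t ∧ g t * y t ^ ((p + 1) / 2) ≤ y' t := by
  set r := (p + 1) / 2 with hr
  have hr1 : 1 < r := by rw [hr]; linarith
  -- With `|y|` instead of `y` the quantity `D` controls the sign of `y'` even where `y < 0`.
  set D : ℝ → ℝ := fun s => y' s - g s * |y s| ^ r with hD
  have hcy : ContinuousOn y (Ico 0 T) := fun s hs => (hy s hs).continuousWithinAt
  have hcD : ContinuousOn D (Ico 0 T) := by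
    refine ContinuousOn.sub (fun s hs => (hy' s hs).continuousWithinAt) ?_
    refine ContinuousOn.mul (fun s hs => (hg s hs).continuousWithinAt) ?_
    exact hcy.abs.rpow_const fun s _ => Or.inr (by linarith)
  have hone : ∀ s ∈ Ico 0 T, (∀ τ ∈ Ico 0 s, 0 < D τ) → 1 ≤ y s := by
    intro s hs hpos
    have hmono : MonotoneOn y (Icc 0 s) := by
      have hsub : Icc 0 s ⊆ Ico 0 T := fun x hx => ⟨hx.1, hx.2.trans_lt hs.2⟩
      refine monotoneOn_of_hasDerivWithinAt_nonneg (convex_Icc 0 s) (hcy.mono hsub)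
        (f' := y') ?_ ?_
      · intro x hx
        exact (hy x (hsub (interior_subset hx))).mono (interior_subset.trans hsub)
      · intro x hx
        rw [interior_Icc] at hx
        have h1 := hpos x ⟨hx.1.le, hx.2⟩
        have h2 : 0 ≤ g x * |y x| ^ r :=
          mul_nonneg (hg0 x ⟨hx.1.le, hx.2.trans hs.2⟩) (by positivity)
        simp only [hD] at h1
        linarith
    exact h0.trans (hmono ⟨le_rfl, hs.1⟩ ⟨hs.1, le_rfl⟩ hs.1)
  have hDpos : ∀ s ∈ Ico 0 T, 0 < D s := by
    by_contra! hcon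
    obtain ⟨s₁, hs₁, hDs₁⟩ := hcon
    have hsub : Icc 0 s₁ ⊆ Ico 0 T := fun x hx => ⟨hx.1, hx.2.trans_lt hs₁.2⟩
    have hclosed : IsCompact (Icc 0 s₁ ∩ D ⁻¹' Iic 0) :=
      isCompact_Icc.of_isClosed_subset
        ((hcD.mono hsub).preimage_isClosed_of_isClosed isClosed_Icc isClosed_Iic)
        inter_subset_left
    obtain ⟨s, ⟨hs, hDs⟩, hmin⟩ := hclosed.exists_isLeast ⟨s₁, ⟨hs₁.1, le_rfl⟩, hDs₁⟩
    have hsT := hsub hs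
    have hbefore : ∀ τ ∈ Ico 0 s, 0 < D τ := by
      intro τ hτ
      by_contra! hle
      exact absurd (hmin ⟨⟨hτ.1, hτ.2.le.trans hs.2⟩, hle⟩) (not_le.2 hτ.2)
    have hD0 : 0 < D 0 := by
      simp only [hD, abs_of_pos (zero_lt_one.trans_le h0)]; linarith
    have hs0 : 0 < s := by
      rcases hs.1.eq_or_lt with h | h
      · rw [← h] at hDs; exact absurd hDs (not_le.2 hD0)
      · exact h
    have hys : 1 ≤ y s := hone s hsT hbefore
    have hys0 : 0 < y s := by linarith
    have hderiv : HasDerivWithinAt D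
        (y'' s - (g' s * y s ^ r + g s * (y' s * r * y s ^ (r - 1)))) (Ico 0 T) s := by
      have h1 := (hy' s hsT).sub ((hg s hsT).mul ((hy s hsT).rpow_const (p := r) (Or.inl hys0.ne')))
      refine h1.congr_of_eventuallyEq ?_ ?_
      · have : ∀ᶠ x in nhdsWithin s (Ico 0 T), 0 < y x :=
          (hcy s hsT).eventually (lt_mem_nhds hys0)
        filter_upwards [this] with x hx
        simp [hD, abs_of_pos hx]
      · simp [hD, abs_of_pos hys0]
    have hle : y'' s - (g' s * y s ^ r + g s * (y' s * r * y s ^ (r - 1))) ≤ 0 := by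
      have h1 : HasDerivWithinAt D _ (Iio s ∩ Ico 0 T) s := hderiv.mono inter_subset_right
      rw [hasDerivWithinAt_iff_tendsto_slope' (by simp)] at h1
      have hnb : nhdsWithin s (Iio s ∩ Ico 0 T) = nhdsWithin s (Iio s) := by
        have hmem : Ico 0 T ∈ nhdsWithin s (Iio s) :=
          Filter.mem_of_superset (Ico_mem_nhdsLT hs0) fun x hx => ⟨hx.1, hx.2.trans hsT.2⟩
        exact nhdsWithin_inter_of_mem' hmem
      rw [hnb] at h1
      refine le_of_tendsto h1 ?_
      filter_upwards [Ico_mem_nhdsLT hs0] with x hx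
      rw [slope_def_field]
      have h2 := hbefore x hx
      have h3 : D s ≤ 0 := hDs
      exact div_nonpos_of_nonneg_of_nonpos (by linarith) (by linarith [hx.2])
    have hys' : y' s ≤ g s * y s ^ r := by
      have h3 : D s ≤ 0 := hDs
      simp only [hD, abs_of_pos hys0] at h3
      linarith
    have e1 : y s ^ (r - 1) * y s ^ r = y s ^ p := by
      rw [← Real.rpow_add hys0, hr]; congr 1; ring
    have e2 : y s ^ r ≤ y s ^ p := Real.rpow_le_rpow_of_exponent_le hys (by rw [hr]; linarith)
    have hr0 : 0 ≤ y s ^ r := by positivity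
    have hr1' : 0 ≤ y s ^ (r - 1) := by positivity
    have hp0 : 0 < y s ^ p := by positivity
    have k1 := hode s hsT hys
    have k2 := hric s hsT
    have k3 : b s * y' s ≤ b s * g s * y s ^ p := by
      calc b s * y' s ≤ b s * (g s * y s ^ r) := mul_le_mul_of_nonneg_left hys' (hb s hsT)
        _ = b s * g s * y s ^ r := by ring
        _ ≤ _ := mul_le_mul_of_nonneg_left e2 (mul_nonneg (hb s hsT) (hg0 s hsT))
    have k4 : g' s * y s ^ r ≤ |g' s| * y s ^ p :=
      (mul_le_mul_of_nonneg_right (le_abs_self _) hr0).trans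
        (mul_le_mul_of_nonneg_left e2 (abs_nonneg _))
    have k5 : g s * (y' s * r * y s ^ (r - 1)) ≤ r * g s ^ 2 * y s ^ p := by
      calc g s * (y' s * r * y s ^ (r - 1))
          = (g s * r * y s ^ (r - 1)) * y' s := by ring
        _ ≤ (g s * r * y s ^ (r - 1)) * (g s * y s ^ r) :=
          mul_le_mul_of_nonneg_left hys'
            (mul_nonneg (mul_nonneg (hg0 s hsT) (by linarith)) hr1')
        _ = r * g s ^ 2 * (y s ^ (r - 1) * y s ^ r) := by ring
        _ = _ := by rw [e1]
    have k6 := mul_lt_mul_of_pos_right k2 hp0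
    nlinarith
  have hyt : 1 ≤ y t := hone t ht fun τ hτ => hDpos τ ⟨hτ.1, hτ.2.trans ht.2⟩
  refine ⟨hyt, ?_⟩
  have := hDpos t ht
  simp only [hD, abs_of_pos (zero_lt_one.trans_le hyt)] at this
  linarith

/-- A solution of `y' ≥ G' y^r` with `r > 1` and `y ≥ 1` cannot exist for longer than `G` takes to
grow by `1/(r-1)`, because `y^{-(r-1)} + (r-1) G` is nonincreasing. -/
theorem sub_le_of_rpow_growth {r t₀ T : ℝ} (hr : 1 < r) {G G' y y' : ℝ → ℝ}
    (hy : ∀ t ∈ Ico t₀ T, HasDerivWithinAt y (y' t) (Ico t₀ T) t)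
    (hG : ∀ t ∈ Ico t₀ T, HasDerivWithinAt G (G' t) (Ico t₀ T) t)
    (h1 : ∀ t ∈ Ico t₀ T, 1 ≤ y t) (h2 : ∀ t ∈ Ico t₀ T, G' t * y t ^ r ≤ y' t)
    {t : ℝ} (ht : t ∈ Ico t₀ T) : G t - G t₀ ≤ 1 / (r - 1) := by
  have hΦ : ∀ s ∈ Ico t₀ T, HasDerivWithinAt (fun s => y s ^ (-(r - 1)) + (r - 1) * G s)
      (y' s * (-(r - 1)) * y s ^ (-(r - 1) - 1) + (r - 1) * G' s) (Ico t₀ T) s := fun s hs =>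
    ((hy s hs).rpow_const (Or.inl (by linarith [h1 s hs]))).add ((hG s hs).const_mul _)
  have hanti : AntitoneOn (fun s => y s ^ (-(r - 1)) + (r - 1) * G s) (Ico t₀ T) := by
    refine antitoneOn_of_hasDerivWithinAt_nonpos (convex_Ico t₀ T)
      (fun s hs => (hΦ s hs).continuousWithinAt)
      (fun s hs => (hΦ s (interior_subset hs)).mono interior_subset) fun s hs => ?_
    have hs := interior_subset hs
    have hy0 : 0 < y s := by linarith [h1 s hs]
    have e : y s ^ (-(r - 1) - 1) = (y s ^ r)⁻¹ := by
      rw [← Real.rpow_neg hy0.le]; congr 1; ring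
    have h3 : G' s ≤ y' s * (y s ^ r)⁻¹ := by
      rw [← div_eq_mul_inv, le_div_iff₀ (by positivity)]; exact h2 s hs
    rw [e]
    nlinarith
  have ht₀ : t₀ ∈ Ico t₀ T := ⟨le_rfl, ht.1.trans_lt ht.2⟩
  have h3 := hanti ht₀ ht ht.1
  simp only at h3
  have h4 : y t₀ ^ (-(r - 1)) ≤ 1 :=
    Real.rpow_le_one_of_one_le_of_nonpos (h1 t₀ ht₀) (by linarith)
  have h5 : 0 ≤ y t ^ (-(r - 1)) := Real.rpow_nonneg (by linarith [h1 t ht]) _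
  rw [le_div_iff₀ (by linarith)]
  nlinarith

/-- `y` is a supersolution of `y'' + b y' = lam y^p` on `[0,T)`, as long as `y ≥ 1`, with data
`y(0) ∈ [1, Y]`, `y'(0) ≥ V` and damping `0 < b(t) ≤ b₂ (1+t)^{-β}`. -/
structure IsDampedSupersolution (p β b₂ Y V lam T : ℝ) (b y y' y'' : ℝ → ℝ) : Prop where
  hasDeriv : ∀ t ∈ Ico 0 T, HasDerivWithinAt y (y' t) (Ico 0 T) t
  hasDeriv' : ∀ t ∈ Ico 0 T, HasDerivWithinAt y' (y'' t) (Ico 0 T) t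
  damping_pos : ∀ t ∈ Ico 0 T, 0 < b t
  damping_le : ∀ t ∈ Ico 0 T, b t ≤ b₂ * (1 + t) ^ (-β)
  one_le : 1 ≤ y 0
  le_init : y 0 ≤ Y
  init_deriv : V ≤ y' 0
  ineq : ∀ t ∈ Ico 0 T, 1 ≤ y t → lam * y t ^ p ≤ y'' t + b t * y' t

/-- The barrier with a Riccati subsolution of size `η lam`, where `η` is small depending only on
the data. -/
theorem IsDampedSupersolution.barrier {p β b₂ Y V lam T η : ℝ} {b y y' y'' : ℝ → ℝ}
    (h : IsDampedSupersolution p β b₂ Y V lam T b y y' y'') (hp : 1 < p)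
    (hlam : 0 < lam) (hlam1 : lam ≤ 1) (hη : 0 < η)
    (hη1 : η * (1 + b₂ + (p + 1) / 2) < 1) (hη2 : η * Y ^ ((p + 1) / 2) < V) (hb₂ : 0 < b₂)
    {g g' : ℝ → ℝ} (hg : ∀ t ∈ Ico 0 T, HasDerivWithinAt g (g' t) (Ico 0 T) t)
    (hg0 : ∀ t ∈ Ico 0 T, 0 ≤ g t)
    (hbg : ∀ t ∈ Ico 0 T, (1 + t) ^ (-β) * g t ≤ η * lam)
    (hg' : ∀ t ∈ Ico 0 T, |g' t| ≤ η * lam)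
    (hg2 : ∀ t ∈ Ico 0 T, g t ^ 2 ≤ η ^ 2 * lam) (hT : 0 < T) :
    ∀ t ∈ Ico 0 T, 1 ≤ y t ∧ g t * y t ^ ((p + 1) / 2) ≤ y' t := by
  intro t ht
  have hη3 : η ≤ 1 := by
    by_contra! hc
    nlinarith
  have h00 : (0 : ℝ) ∈ Ico 0 T := ⟨le_rfl, hT⟩
  refine rpow_barrier_of_damped_ineq hp h.hasDeriv h.hasDeriv' hg hg0
    (fun t ht => (h.damping_pos t ht).le) h.ineq (fun s hs => ?_) h.one_le ?_ ht
  · have k1 : b s * g s ≤ b₂ * (η * lam) := by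
      calc b s * g s ≤ b₂ * (1 + s) ^ (-β) * g s :=
            mul_le_mul_of_nonneg_right (h.damping_le s hs) (hg0 s hs)
        _ = b₂ * ((1 + s) ^ (-β) * g s) := by ring
        _ ≤ _ := mul_le_mul_of_nonneg_left (hbg s hs) hb₂.le
    have k2 : (p + 1) / 2 * g s ^ 2 ≤ (p + 1) / 2 * (η * lam) := by
      refine mul_le_mul_of_nonneg_left ((hg2 s hs).trans ?_) (by linarith)
      nlinarith [mul_pos hη hlam]
    have k3 := hg' s hs
    have k4 := mul_lt_mul_of_pos_right hη1 hlam
    nlinarith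
  · have k1 := hbg 0 h00
    simp only [add_zero, Real.one_rpow, one_mul] at k1
    have k2 : y 0 ^ ((p + 1) / 2) ≤ Y ^ ((p + 1) / 2) :=
      Real.rpow_le_rpow (by linarith [h.one_le]) h.le_init (by linarith)
    have k3 : 0 < y 0 ^ ((p + 1) / 2) := Real.rpow_pos_of_pos (by linarith [h.one_le]) _
    calc g 0 * y 0 ^ ((p + 1) / 2) ≤ η * Y ^ ((p + 1) / 2) := by
          refine mul_le_mul (k1.trans ?_) k2 k3.le hη.le
          nlinarith
      _ < V := hη2
      _ ≤ y' 0 := h.init_deriv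

/-- For `β ≤ 0` the barrier is `g = η lam (1+t)^β`. -/
theorem IsDampedSupersolution.growth_of_nonpos {p β b₂ Y V lam T η : ℝ} {b y y' y'' : ℝ → ℝ}
    (h : IsDampedSupersolution p β b₂ Y V lam T b y y' y'') (hp : 1 < p)
    (hlam : 0 < lam) (hlam1 : lam ≤ 1) (hη : 0 < η)
    (hη1 : η * (1 + b₂ + (p + 1) / 2) < 1) (hη2 : η * Y ^ ((p + 1) / 2) < V) (hb₂ : 0 < b₂)
    (hβ₀ : -1 ≤ β) (hβ₁ : β ≤ 0) (hT : 0 < T) :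
    ∀ t ∈ Ico 0 T, 1 ≤ y t ∧ η * lam * (1 + t) ^ β * y t ^ ((p + 1) / 2) ≤ y' t := by
  have hpos : ∀ t ∈ Ico 0 T, 0 < 1 + t := fun t ht => by linarith [ht.1]
  have hηl : 0 < η * lam := mul_pos hη hlam
  have hle1 : ∀ t ∈ Ico 0 T, (1 + t) ^ β ≤ 1 := fun t ht =>
    Real.rpow_le_one_of_one_le_of_nonpos (by linarith [ht.1]) hβ₁
  refine h.barrier hp hlam hlam1 hη hη1 hη2 hb₂ (g' := fun t => η * lam * (1 * β * (1 + t) ^ (β - 1)))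
    (fun t ht => ?_) (fun t ht => ?_) (fun t ht => ?_) (fun t ht => ?_) (fun t ht => ?_) hT
  · exact (((hasDerivAt_id t).const_add 1).hasDerivWithinAt.rpow_const
      (Or.inl (hpos t ht).ne')).const_mul _
  · have := hpos t ht
    positivity
  · rw [Real.rpow_neg (hpos t ht).le]
    have := (Real.rpow_pos_of_pos (hpos t ht) β).ne'
    exact le_of_eq (by field_simp)
  · have k1 : (1 + t) ^ (β - 1) ≤ 1 :=
      Real.rpow_le_one_of_one_le_of_nonpos (by linarith [ht.1]) (by linarith)
    have k2 : 0 < (1 + t) ^ (β - 1) := Real.rpow_pos_of_pos (hpos t ht) _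
    rw [one_mul, abs_mul, abs_mul β, abs_of_pos hηl, abs_of_pos k2]
    have k3 : |β| ≤ 1 := abs_le.2 ⟨hβ₀, by linarith⟩
    nlinarith [mul_le_mul k3 k1 k2.le zero_le_one]
  · have k1 := hle1 t ht
    have k2 : 0 < (1 + t) ^ β := Real.rpow_pos_of_pos (hpos t ht) _
    have k3 : ((1 + t) ^ β) ^ 2 ≤ 1 := by nlinarith
    calc (η * lam * (1 + t) ^ β) ^ 2 = η ^ 2 * (lam * lam * ((1 + t) ^ β) ^ 2) := by ring
      _ ≤ η ^ 2 * lam := by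
          refine mul_le_mul_of_nonneg_left ?_ (by positivity)
          nlinarith [mul_pos hlam hlam]

theorem IsDampedSupersolution.le_of_neg_one_lt_of_nonpos {p β b₂ Y V lam T η : ℝ}
    {b y y' y'' : ℝ → ℝ}
    (h : IsDampedSupersolution p β b₂ Y V lam T b y y' y'') (hp : 1 < p)
    (hlam : 0 < lam) (hlam1 : lam ≤ 1) (hη : 0 < η)
    (hη1 : η * (1 + b₂ + (p + 1) / 2) < 1) (hη2 : η * Y ^ ((p + 1) / 2) < V) (hb₂ : 0 < b₂)
    (hβ₀ : -1 < β) (hβ₁ : β ≤ 0) (hT : 0 < T) :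
    T ≤ (1 + (1 + β) / (η * ((p - 1) / 2))) ^ (1 / (1 + β)) * lam ^ (-(1 / (1 + β))) := by
  have hg := h.growth_of_nonpos hp hlam hlam1 hη hη1 hη2 hb₂ hβ₀.le hβ₁ hT
  have hβ : 0 < 1 + β := by linarith
  have hηl : 0 < η * lam := mul_pos hη hlam
  refine le_of_forall_lt_imp_le_of_dense fun t htT => ?_
  rcases lt_or_ge t 0 with ht0 | ht0
  · refine ht0.le.trans ?_
    have : 0 < p - 1 := by linarith
    positivity
  have ht : t ∈ Ico 0 T := ⟨ht0, htT⟩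
  have hpos : ∀ t ∈ Ico 0 T, 0 < 1 + t := fun t ht => by linarith [ht.1]
  have k := sub_le_of_rpow_growth (r := (p + 1) / 2) (by linarith)
    (G := fun t => η * lam / (1 + β) * (1 + t) ^ (1 + β))
    (G' := fun t => η * lam * (1 + t) ^ β) h.hasDeriv (fun s hs => ?_)
    (fun s hs => (hg s hs).1) (fun s hs => (hg s hs).2) ht
  · have e : (p + 1) / 2 - 1 = (p - 1) / 2 := by ring
    simp only [add_zero, Real.one_rpow, e] at k
    have hp2 : 0 < (p - 1) / 2 := by linarith
    have k1 : (1 + t) ^ (1 + β) ≤ (1 + (1 + β) / (η * ((p - 1) / 2))) / lam := by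
      have k2 : (1 + t) ^ (1 + β) ≤ 1 + (1 + β) / (η * lam * ((p - 1) / 2)) := by
        have : (1 + t) ^ (1 + β) - 1 ≤ (1 + β) / (η * lam) * (1 / ((p - 1) / 2)) := by
          calc (1 + t) ^ (1 + β) - 1 = (1 + β) / (η * lam) *
                (η * lam / (1 + β) * (1 + t) ^ (1 + β) - η * lam / (1 + β) * 1) := by
                field_simp
            _ ≤ _ := mul_le_mul_of_nonneg_left k (by positivity)
        have e2 : (1 + β) / (η * lam) * (1 / ((p - 1) / 2))
          = (1 + β) / (η * lam * ((p - 1) / 2)) := by rw [div_mul_div_comm, mul_one]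
        linarith
      refine k2.trans ?_
      rw [add_div (1 : ℝ) _ lam]
      refine add_le_add ?_ (le_of_eq ?_)
      · rw [le_div_iff₀ hlam]; linarith
      · field_simp
    have k3 : 1 + t ≤ ((1 + (1 + β) / (η * ((p - 1) / 2))) / lam) ^ (1 / (1 + β)) := by
      have := Real.rpow_le_rpow (Real.rpow_nonneg (hpos t ht).le _) k1
        (by positivity : (0 : ℝ) ≤ 1 / (1 + β))
      rwa [← Real.rpow_mul (hpos t ht).le, mul_one_div_cancel hβ.ne', Real.rpow_one] at this
    rw [Real.div_rpow (by positivity) hlam.le, div_eq_mul_inv, ← Real.rpow_neg hlam.le] at k3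
    linarith
  · have hs0 := hpos s hs
    have := (((hasDerivAt_id s).const_add 1).hasDerivWithinAt (s := Ico 0 T)).rpow_const
      (p := 1 + β) (Or.inl hs0.ne') |>.const_mul (η * lam / (1 + β))
    refine this.congr_deriv ?_
    simp only [id, add_sub_cancel_left]
    field_simp

theorem IsDampedSupersolution.le_of_eq_neg_one {p b₂ Y V lam T η : ℝ}
    {b y y' y'' : ℝ → ℝ}
    (h : IsDampedSupersolution p (-1) b₂ Y V lam T b y y' y'') (hp : 1 < p)
    (hlam : 0 < lam) (hlam1 : lam ≤ 1) (hη : 0 < η)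
    (hη1 : η * (1 + b₂ + (p + 1) / 2) < 1) (hη2 : η * Y ^ ((p + 1) / 2) < V) (hb₂ : 0 < b₂)
    (hT : 0 < T) :
    T ≤ Real.exp (1 / (η * ((p - 1) / 2)) * lam⁻¹) := by
  have hg := h.growth_of_nonpos hp hlam hlam1 hη hη1 hη2 hb₂ le_rfl (by norm_num) hT
  have hηl : 0 < η * lam := mul_pos hη hlam
  refine le_of_forall_lt_imp_le_of_dense fun t htT => ?_
  rcases lt_or_ge t 0 with ht0 | ht0
  · exact ht0.le.trans (Real.exp_pos _).le
  have ht : t ∈ Ico 0 T := ⟨ht0, htT⟩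
  have hpos : ∀ t ∈ Ico 0 T, 0 < 1 + t := fun t ht => by linarith [ht.1]
  have k := sub_le_of_rpow_growth (r := (p + 1) / 2) (by linarith)
    (G := fun t => η * lam * Real.log (1 + t))
    (G' := fun t => η * lam * (1 + t) ^ (-1 : ℝ)) h.hasDeriv (fun s hs => ?_)
    (fun s hs => (hg s hs).1) (fun s hs => (hg s hs).2) ht
  · have e : (p + 1) / 2 - 1 = (p - 1) / 2 := by ring
    simp only [add_zero, Real.log_one, e, mul_zero, sub_zero] at k
    have k2 : Real.log (1 + t) ≤ 1 / (η * ((p - 1) / 2)) * lam⁻¹ := by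
      calc Real.log (1 + t) = (η * lam)⁻¹ * (η * lam * Real.log (1 + t)) := by field_simp
        _ ≤ (η * lam)⁻¹ * (1 / ((p - 1) / 2)) :=
          mul_le_mul_of_nonneg_left k (by positivity)
        _ = _ := by field_simp
    have := (Real.log_le_iff_le_exp (hpos t ht)).1 k2
    linarith
  · have hs0 := hpos s hs
    have := ((((hasDerivAt_id s).const_add 1).hasDerivWithinAt (s := Ico 0 T)).log
      hs0.ne').const_mul (η * lam)
    refine this.congr_deriv ?_
    rw [Real.rpow_neg_one, id, one_div]

/-- For `β > 0` the barrier is `g = η lam ((1+t)⁻¹ + L)^{-β}` with `L = lam^{1/(1+β)}`. It is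
comparable to `η lam (1+t)^β` before the time `1/L` and to the constant `η L` after it, so that
`g² ≤ η² lam` for all times, and the growth after the time `1/L` suffices for blow-up. -/
theorem IsDampedSupersolution.le_of_pos {p β b₂ Y V lam T η : ℝ}
    {b y y' y'' : ℝ → ℝ}
    (h : IsDampedSupersolution p β b₂ Y V lam T b y y' y'') (hp : 1 < p)
    (hlam : 0 < lam) (hlam1 : lam ≤ 1) (hη : 0 < η)
    (hη1 : η * (1 + b₂ + (p + 1) / 2) < 1) (hη2 : η * Y ^ ((p + 1) / 2) < V) (hb₂ : 0 < b₂)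
    (hβ₀ : 0 < β) (hβ₁ : β ≤ 1) (hT : 0 < T) :
    T ≤ (1 + 2 ^ β / (η * ((p - 1) / 2))) * lam ^ (-(1 / (1 + β))) := by
  have hβ : 0 < 1 + β := by linarith
  have hηl : 0 < η * lam := mul_pos hη hlam
  have hp2 : 0 < (p - 1) / 2 := by linarith
  set L := lam ^ (1 / (1 + β)) with hL
  have hL0 : 0 < L := Real.rpow_pos_of_pos hlam _
  have hL1 : L ≤ 1 := Real.rpow_le_one hlam.le hlam1 (by positivity)
  have hlamL : lam = L ^ (1 + β) := by
    rw [hL, ← Real.rpow_mul hlam.le, one_div_mul_cancel hβ.ne', Real.rpow_one]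
  have hpos : ∀ t ∈ Ico 0 T, 0 < 1 + t := fun t ht => by linarith [ht.1]
  have hhpos : ∀ t ∈ Ico 0 T, 0 < (1 + t)⁻¹ + L := fun t ht => by
    have := hpos t ht; positivity
  have hle1 : ∀ t ∈ Ico 0 T, ∀ a : ℝ, 0 ≤ a → ((1 + t)⁻¹ + L) ^ (-a) ≤ (1 + t) ^ a := by
    intro t ht a ha
    have h1 := hpos t ht
    calc ((1 + t)⁻¹ + L) ^ (-a) ≤ ((1 + t)⁻¹) ^ (-a) :=
          Real.rpow_le_rpow_of_nonpos (by positivity) (by linarith) (by linarith)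
      _ = (1 + t) ^ a := by rw [Real.inv_rpow h1.le, Real.rpow_neg h1.le, inv_inv]
  have hle2 : ∀ t ∈ Ico 0 T, ((1 + t)⁻¹ + L) ^ (-β) ≤ L ^ (-β) := fun t ht =>
    Real.rpow_le_rpow_of_nonpos hL0
      (by have := inv_pos.2 (hpos t ht); linarith) (by linarith)
  have hlamL2 : lam * L ^ (-β) = L := by
    rw [hlamL, ← Real.rpow_add hL0]; simp
  have hg := h.barrier hp hlam hlam1 hη hη1 hη2 hb₂
    (g := fun t => η * lam * ((1 + t)⁻¹ + L) ^ (-β))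
    (g' := fun t => η * lam * (-1 / (1 + t) ^ 2 * (-β) * ((1 + t)⁻¹ + L) ^ (-β - 1)))
    (fun t ht => ?_) (fun t ht => ?_) (fun t ht => ?_) (fun t ht => ?_) (fun t ht => ?_) hT
  · rw [Real.rpow_neg hlam.le, ← hL]
    rcases le_or_gt T (1 / L) with hTL | hTL
    · refine hTL.trans ?_
      rw [one_div]
      exact le_mul_of_one_le_left (by positivity) (by
        have : 0 ≤ 2 ^ β / (η * ((p - 1) / 2)) := by positivity
        linarith)
    refine le_of_forall_lt_imp_le_of_dense fun t htT => ?_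
    rcases lt_or_ge t (1 / L) with ht0 | ht0
    · refine ht0.le.trans ?_
      rw [one_div]
      exact le_mul_of_one_le_left (by positivity) (by
        have : 0 ≤ 2 ^ β / (η * ((p - 1) / 2)) := by positivity
        linarith)
    have hsub : Ico (1 / L) T ⊆ Ico 0 T := Ico_subset_Ico_left (by positivity)
    have k := sub_le_of_rpow_growth (r := (p + 1) / 2) (by linarith)
      (G := fun t => η * 2 ^ (-β) * L * t) (G' := fun t => η * 2 ^ (-β) * L)
      (fun s hs => (h.hasDeriv s (hsub hs)).mono hsub) (fun s hs => ?_)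
      (fun s hs => (hg s (hsub hs)).1) (fun s hs => ?_) ⟨ht0, htT⟩
    · have e : (p + 1) / 2 - 1 = (p - 1) / 2 := by ring
      rw [e, ← mul_sub] at k
      have h2 : (0 : ℝ) < 2 ^ (-β) := by positivity
      have k2 : t - 1 / L ≤ (η * 2 ^ (-β) * L)⁻¹ * (1 / ((p - 1) / 2)) := by
        rw [← div_eq_inv_mul, le_div_iff₀ (by positivity)]; linarith
      have e2 : (η * 2 ^ (-β) * L)⁻¹ * (1 / ((p - 1) / 2))
          = 2 ^ β / (η * ((p - 1) / 2)) * L⁻¹ := by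
        rw [Real.rpow_neg zero_le_two]
        field_simp
      rw [e2, one_div] at k2
      linarith
    · simpa using ((hasDerivAt_id s).const_mul (η * 2 ^ (-β) * L)).hasDerivWithinAt
    · refine le_trans (mul_le_mul_of_nonneg_right ?_ ?_) (hg s (hsub hs)).2
      · have h1 : (1 + s)⁻¹ ≤ L := by
          rw [inv_le_comm₀ (hpos s (hsub hs)) hL0]
          have := hs.1
          rw [one_div] at this
          linarith
        have h2 : (2 * L) ^ (-β) ≤ ((1 + s)⁻¹ + L) ^ (-β) :=
          Real.rpow_le_rpow_of_nonpos (hhpos s (hsub hs)) (by linarith) (by linarith)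
        rw [Real.mul_rpow zero_le_two hL0.le] at h2
        calc η * 2 ^ (-β) * L = η * 2 ^ (-β) * (lam * L ^ (-β)) := by rw [hlamL2]
          _ = η * lam * (2 ^ (-β) * L ^ (-β)) := by ring
          _ ≤ _ := mul_le_mul_of_nonneg_left h2 hηl.le
      · exact Real.rpow_nonneg (by linarith [(hg s (hsub hs)).1]) _
  · have h1 := ((((hasDerivAt_id t).const_add 1).inv (hpos t ht).ne').add_const L).rpow_const
      (p := -β) (Or.inl (hhpos t ht).ne')
    exact (h1.const_mul (η * lam)).hasDerivWithinAt
  · have := hhpos t ht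
    positivity
  · have h1 := hpos t ht
    calc (1 + t) ^ (-β) * (η * lam * ((1 + t)⁻¹ + L) ^ (-β))
        ≤ (1 + t) ^ (-β) * (η * lam * (1 + t) ^ β) := by
          have := hle1 t ht β hβ₀.le
          gcongr
      _ = η * lam := by
          rw [Real.rpow_neg h1.le]
          field_simp
  · have h1 := hpos t ht
    have k1 := hle1 t ht (β + 1) (by linarith)
    have e : -(β + 1) = -β - 1 := by ring
    rw [e] at k1
    have k0 : 0 < ((1 + t)⁻¹ + L) ^ (-β - 1) := Real.rpow_pos_of_pos (hhpos t ht) _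
    have k2 : (1 + t) ^ (β + 1) ≤ (1 + t) ^ 2 := by
      rw [← Real.rpow_two]
      exact Real.rpow_le_rpow_of_exponent_le (by linarith [ht.1]) (by linarith)
    have e2 : -1 / (1 + t) ^ 2 * (-β) * ((1 + t)⁻¹ + L) ^ (-β - 1)
        = β * (((1 + t)⁻¹ + L) ^ (-β - 1) / (1 + t) ^ 2) := by ring
    have k3 : ((1 + t)⁻¹ + L) ^ (-β - 1) / (1 + t) ^ 2 ≤ 1 := by
      rw [div_le_one (by positivity)]; exact k1.trans k2
    have k4 : 0 ≤ ((1 + t)⁻¹ + L) ^ (-β - 1) / (1 + t) ^ 2 := by positivity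
    rw [e2, abs_of_nonneg (by positivity)]
    have : β * (((1 + t)⁻¹ + L) ^ (-β - 1) / (1 + t) ^ 2) ≤ 1 := by nlinarith
    nlinarith
  · have h1 := hhpos t ht
    have k1 := hle2 t ht
    have k2 : 0 < ((1 + t)⁻¹ + L) ^ (-β) := Real.rpow_pos_of_pos h1 _
    have k3 : lam * ((1 + t)⁻¹ + L) ^ (-β) ≤ L :=
      (mul_le_mul_of_nonneg_left k1 hlam.le).trans_eq hlamL2
    have k4 : L ^ 2 ≤ lam := by
      rw [hlamL, ← Real.rpow_two]
      exact Real.rpow_le_rpow_of_exponent_ge hL0 hL1 (by linarith)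
    calc (η * lam * ((1 + t)⁻¹ + L) ^ (-β)) ^ 2
        = η ^ 2 * (lam * ((1 + t)⁻¹ + L) ^ (-β)) ^ 2 := by ring
      _ ≤ η ^ 2 * L ^ 2 := by gcongr
      _ ≤ _ := by gcongr

/-- The lifespan of a supersolution is bounded by a multiple of `lam^{-1/(1+β)}` (its logarithm by
a multiple of `1/lam` if `β = -1`), with a constant depending only on the data. -/
theorem exists_lifespan_bound {p β b₂ Y V : ℝ} (hp : 1 < p) (hβ₀ : -1 ≤ β) (hβ₁ : β ≤ 1)
    (hb₂ : 0 < b₂) (hV : 0 < V) (hY : 0 < Y) :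
    ∃ C : ℝ, 0 < C ∧ ∀ lam T : ℝ, 0 < lam → lam ≤ 1 → 0 < T → ∀ b y y' y'' : ℝ → ℝ,
      IsDampedSupersolution p β b₂ Y V lam T b y y' y'' →
      (-1 < β → T ≤ C * lam ^ (-(1 / (1 + β)))) ∧
      (β = -1 → T ≤ Real.exp (C * lam⁻¹)) := by
  have hYr : 0 < Y ^ ((p + 1) / 2) := Real.rpow_pos_of_pos hY _
  set η := min (1 / (2 * (1 + b₂ + (p + 1) / 2))) (V / (2 * Y ^ ((p + 1) / 2))) with hη
  have hη0 : 0 < η := lt_min (by positivity) (by positivity)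
  have hη1 : η * (1 + b₂ + (p + 1) / 2) < 1 := by
    have := min_le_left (1 / (2 * (1 + b₂ + (p + 1) / 2))) (V / (2 * Y ^ ((p + 1) / 2)))
    rw [← hη, le_div_iff₀ (by positivity)] at this
    linarith
  have hη2 : η * Y ^ ((p + 1) / 2) < V := by
    have := min_le_right (1 / (2 * (1 + b₂ + (p + 1) / 2))) (V / (2 * Y ^ ((p + 1) / 2)))
    rw [← hη, le_div_iff₀ (by positivity)] at this
    linarith
  have hp2 : 0 < p - 1 := by linarith
  rcases hβ₀.eq_or_lt with rfl | hβ
  · refine ⟨1 / (η * ((p - 1) / 2)), by positivity, fun lam T h1 h2 hT b y y' y'' h =>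
      ⟨fun h => absurd h (lt_irrefl _), fun _ => ?_⟩⟩
    exact h.le_of_eq_neg_one hp h1 h2 hη0 hη1 hη2 hb₂ hT
  have hβ' : 0 < 1 + β := by linarith
  rcases le_or_gt β 0 with hβ2 | hβ2
  · refine ⟨_, ?_, fun lam T h1 h2 hT b y y' y'' h =>
      ⟨fun _ => h.le_of_neg_one_lt_of_nonpos hp h1 h2 hη0 hη1 hη2 hb₂ hβ hβ2 hT,
        fun h => absurd h hβ.ne'⟩⟩
    positivity
  · refine ⟨_, ?_, fun lam T h1 h2 hT b y y' y'' h =>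
      ⟨fun _ => h.le_of_pos hp h1 h2 hη0 hη1 hη2 hb₂ hβ2 hβ₁ hT,
        fun h => absurd h hβ.ne'⟩⟩
    positivity

/-! ### The weight `⟨x/R⟩^{-q}` -/

theorem one_le_japaneseBracket {N : ℕ} (x : Space N) : 1 ≤ japaneseBracket x := by
  unfold japaneseBracket
  rw [Real.one_le_sqrt]
  linarith [sq_nonneg ‖x‖]

theorem japaneseBracket_pos {N : ℕ} (x : Space N) : 0 < japaneseBracket x :=
  zero_lt_one.trans_le (one_le_japaneseBracket x)

theorem continuous_japaneseBracket {N : ℕ} :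
    Continuous (japaneseBracket : Space N → ℝ) := by
  unfold japaneseBracket; fun_prop

theorem continuous_japaneseBracket_rpow {N : ℕ} (s : ℝ) :
    Continuous fun x : Space N => japaneseBracket x ^ s :=
  continuous_japaneseBracket.rpow_const fun x => Or.inl (japaneseBracket_pos x).ne'

theorem integrable_japaneseBracket_rpow {N : ℕ} {q : ℝ} (hq : (N : ℝ) < q) :
    Integrable (fun x : Space N => japaneseBracket x ^ (-q)) volume := by
  have h := integrable_rpow_neg_one_add_norm_sq (E := Space N) (μ := volume) (r := q)
    (by simpa using hq)
  refine h.congr (Filter.Eventually.of_forall fun x => ?_)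
  simp only [japaneseBracket]
  rw [Real.sqrt_eq_rpow, ← Real.rpow_mul (by positivity)]
  congr 1; ring

theorem weightL1_pos {N : ℕ} {q : ℝ} (hq : (N : ℝ) < q) : 0 < weightL1 N q := by
  unfold weightL1
  refine integral_pos_of_integrable_nonneg_nonzero (x := 0) (continuous_japaneseBracket_rpow _)
    (integrable_japaneseBracket_rpow hq)
    (fun x => (Real.rpow_pos_of_pos (japaneseBracket_pos x) _).le)
    (Real.rpow_pos_of_pos (japaneseBracket_pos _) _).ne'

/-- The test function `⟨x/R⟩^{-q}`. -/
noncomputable def dilatedWeight {N : ℕ} (q R : ℝ) (x : Space N) : ℝ :=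
  japaneseBracket (R⁻¹ • x) ^ (-q)

theorem dilatedWeight_pos {N : ℕ} (q R : ℝ) (x : Space N) : 0 < dilatedWeight q R x :=
  Real.rpow_pos_of_pos (japaneseBracket_pos _) _

theorem dilatedWeight_le_one {N : ℕ} {q : ℝ} (hq : 0 ≤ q) (R : ℝ) (x : Space N) :
    dilatedWeight q R x ≤ 1 :=
  Real.rpow_le_one_of_one_le_of_nonpos (one_le_japaneseBracket _) (by linarith)

theorem continuous_dilatedWeight {N : ℕ} (q R : ℝ) :
    Continuous (dilatedWeight q R : Space N → ℝ) :=
  (continuous_japaneseBracket_rpow (-q)).comp (continuous_const_smul R⁻¹)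

theorem integrable_dilatedWeight {N : ℕ} {q R : ℝ} (hq : (N : ℝ) < q) (hR : 0 < R) :
    Integrable (dilatedWeight q R : Space N → ℝ) volume :=
  (integrable_japaneseBracket_rpow hq).comp_smul (inv_ne_zero hR.ne')

theorem integral_dilatedWeight {N : ℕ} (q : ℝ) {R : ℝ} (hR : 0 < R) :
    ∫ x : Space N, dilatedWeight q R x = R ^ N * weightL1 N q := by
  have h := Measure.integral_comp_inv_smul_of_nonneg (volume : Measure (Space N))
    (fun x => japaneseBracket x ^ (-q)) hR.le
  simpa [dilatedWeight, weightL1] using h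

theorem memLp_dilatedWeight {N : ℕ} {q R : ℝ} (hq : (N : ℝ) < q) (hR : 0 < R) :
    MemLp (dilatedWeight q R : Space N → ℝ) 2 volume := by
  rw [memLp_two_iff_integrable_sq (continuous_dilatedWeight q R).aestronglyMeasurable]
  have hq0 : 0 ≤ q := N.cast_nonneg.trans hq.le
  refine (integrable_dilatedWeight hq hR).mono'
    ((continuous_dilatedWeight q R).pow 2).aestronglyMeasurable
    (Filter.Eventually.of_forall fun x => ?_)
  have h1 := dilatedWeight_pos q R x
  have h2 := dilatedWeight_le_one hq0 R x
  rw [Real.norm_of_nonneg (by positivity)]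
  nlinarith

theorem memLp_japaneseBracket_rpow {N : ℕ} {q : ℝ} (hq : (N : ℝ) < q) :
    MemLp (fun x : Space N => ((japaneseBracket x ^ (-q) : ℝ) : ℂ)) 2 volume := by
  have h := (memLp_dilatedWeight (N := N) hq one_pos).ofReal (K := ℂ)
  simpa [dilatedWeight] using h

/-! ### The weighted average of a solution -/

/-- The function `⟨x⟩^{q/p} (-Δ)^{σ/2} ⟨x⟩^{-q}`, whose `L^{p'}` norm enters the constant `A`. -/
noncomputable def weightedFracLaplacian (N : ℕ) (p σ q : ℝ) (x : Space N) : ℂ :=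
  fracLaplacian σ (fun y : Space N => ((japaneseBracket y ^ (-q) : ℝ) : ℂ)) x *
    ((japaneseBracket x ^ (q / p) : ℝ) : ℂ)

theorem norm_weightedFracLaplacian {N : ℕ} (p σ q : ℝ) (x : Space N) :
    ‖weightedFracLaplacian N p σ q x‖ =
      ‖fracLaplacian σ (fun y : Space N => ((japaneseBracket y ^ (-q) : ℝ) : ℂ)) x‖ *
        japaneseBracket x ^ (q / p) := by
  rw [weightedFracLaplacian, norm_mul, Complex.norm_real,
    Real.norm_of_nonneg (Real.rpow_nonneg (japaneseBracket_pos x).le _)]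

theorem aestronglyMeasurable_weightedFracLaplacian (N : ℕ) (p σ q : ℝ) :
    AEStronglyMeasurable (weightedFracLaplacian N p σ q) volume :=
  (memLp_fracLaplacian σ _).aestronglyMeasurable.mul
    (Complex.continuous_ofReal.comp (continuous_japaneseBracket_rpow _)).aestronglyMeasurable

/-- Young's inequality with the constant produced by the weight `δ` on the first term. -/
theorem young_with_weight {p p' δ a h : ℝ} (hpp : p.HolderConjugate p') (hδ : 0 < δ)
    (ha : 0 ≤ a) (hh : 0 ≤ h) :
    a * h ≤ δ * a ^ p + (δ * p) ^ (-(p' / p)) / p' * h ^ p' := by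
  have hp := hpp.pos
  have hp' := hpp.symm.pos
  have hδp : 0 < δ * p := by positivity
  have h1 := Real.young_inequality_of_nonneg (a := (δ * p) ^ (1 / p) * a)
    (b := (δ * p) ^ (-(1 / p)) * h) (by positivity) (by positivity) hpp
  have e1 : (δ * p) ^ (1 / p) * a * ((δ * p) ^ (-(1 / p)) * h) = a * h := by
    rw [Real.rpow_neg hδp.le]
    have := (Real.rpow_pos_of_pos hδp (1 / p)).ne'
    field_simp
  have e2 : ((δ * p) ^ (1 / p) * a) ^ p / p = δ * a ^ p := by
    rw [Real.mul_rpow (by positivity) ha, ← Real.rpow_mul hδp.le, one_div_mul_cancel hp.ne',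
      Real.rpow_one]
    field_simp
  have e3 : ((δ * p) ^ (-(1 / p)) * h) ^ p' / p' = (δ * p) ^ (-(p' / p)) / p' * h ^ p' := by
    rw [Real.mul_rpow (by positivity) hh, ← Real.rpow_mul hδp.le,
      show -(1 / p) * p' = -(p' / p) by ring]
    ring
  rw [e1, e2, e3] at h1
  exact h1

/-- Hölder's inequality for the average of `u` against a positive weight. -/
theorem abs_integral_mul_rpow_le {α : Type*} [MeasurableSpace α] {μ : Measure α} {p p' : ℝ}
    (hpp : p.HolderConjugate p') {u φ : α → ℝ} (hu : AEStronglyMeasurable u μ)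
    (hφ0 : ∀ x, 0 < φ x) (hφi : Integrable φ μ) (hI : Integrable (fun x => |u x| ^ p * φ x) μ) :
    |∫ x, u x * φ x ∂μ| ^ p ≤ (∫ x, |u x| ^ p * φ x ∂μ) * (∫ x, φ x ∂μ) ^ (p - 1) := by
  have hp := hpp.pos
  have hp' := hpp.symm.pos
  have hI0 : 0 ≤ ∫ x, |u x| ^ p * φ x ∂μ :=
    integral_nonneg fun x => mul_nonneg (by positivity) (hφ0 x).le
  have hW : 0 ≤ ∫ x, φ x ∂μ := integral_nonneg fun x => (hφ0 x).le
  have e1 : ∀ x, (|u x| * φ x ^ (1 / p)) ^ p = |u x| ^ p * φ x := fun x => by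
    rw [Real.mul_rpow (abs_nonneg _) (Real.rpow_nonneg (hφ0 x).le _),
      ← Real.rpow_mul (hφ0 x).le, one_div_mul_cancel hp.ne', Real.rpow_one]
  have e2 : ∀ x, (φ x ^ (1 / p')) ^ p' = φ x := fun x => by
    rw [← Real.rpow_mul (hφ0 x).le, one_div_mul_cancel hp'.ne', Real.rpow_one]
  have e3 : ∀ x, |u x| * φ x ^ (1 / p) * φ x ^ (1 / p') = |u x| * φ x := fun x => by
    rw [mul_assoc, ← Real.rpow_add (hφ0 x), one_div, one_div, hpp.inv_add_inv_eq_one,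
      Real.rpow_one]
  have hφm : AEMeasurable φ μ := hφi.aestronglyMeasurable.aemeasurable
  have hum : AEStronglyMeasurable (fun x => |u x| * φ x ^ (1 / p)) μ :=
    (hu.aemeasurable.abs.mul (hφm.pow_const _)).aestronglyMeasurable
  have hm1 : MemLp (fun x => |u x| * φ x ^ (1 / p)) (ENNReal.ofReal p) μ := by
    rw [← integrable_norm_rpow_iff hum (by simpa using hp) ENNReal.ofReal_ne_top,
      ENNReal.toReal_ofReal hp.le]
    refine hI.congr (Filter.Eventually.of_forall fun x => ?_)
    simp only
    rw [Real.norm_of_nonneg (mul_nonneg (abs_nonneg _) (Real.rpow_nonneg (hφ0 x).le _)), e1]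
  have hm2 : MemLp (fun x => φ x ^ (1 / p')) (ENNReal.ofReal p') μ := by
    rw [← integrable_norm_rpow_iff (hφm.pow_const _).aestronglyMeasurable
      (by simpa using hp') ENNReal.ofReal_ne_top, ENNReal.toReal_ofReal hp'.le]
    refine hφi.congr (Filter.Eventually.of_forall fun x => ?_)
    simp only
    rw [Real.norm_of_nonneg (Real.rpow_nonneg (hφ0 x).le _), e2]
  have h1 := integral_mul_le_Lp_mul_Lq_of_nonneg (μ := μ) hpp
    (Filter.Eventually.of_forall fun x =>
      mul_nonneg (abs_nonneg (u x)) (Real.rpow_nonneg (hφ0 x).le (1 / p)))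
    (Filter.Eventually.of_forall fun x => Real.rpow_nonneg (hφ0 x).le (1 / p')) hm1 hm2
  simp only [e1, e2, e3] at h1
  have h2 : |∫ x, u x * φ x ∂μ| ≤ ∫ x, |u x| * φ x ∂μ := by
    refine (abs_integral_le_integral_abs).trans (le_of_eq ?_)
    congr 1; ext x
    rw [abs_mul, abs_of_pos (hφ0 x)]
  have h3 := Real.rpow_le_rpow (abs_nonneg _) (h2.trans h1) hp.le
  rwa [Real.mul_rpow (Real.rpow_nonneg hI0 _) (Real.rpow_nonneg hW _),
    ← Real.rpow_mul hI0, ← Real.rpow_mul hW, one_div_mul_cancel hp.ne', Real.rpow_one,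
    show 1 / p' * p = p - 1 by rw [one_div_mul_eq_div, hpp.div_conj_eq_sub_one]] at h3

theorem integral_norm_weightedFracLaplacian_dilated {N : ℕ} {p p' σ q R : ℝ} (hR : 0 < R) :
    ∫ x : Space N, (R ^ (-σ) * ‖weightedFracLaplacian N p σ q (R⁻¹ • x)‖) ^ p'
      = R ^ (N - σ * p') * ∫ x, ‖weightedFracLaplacian N p σ q x‖ ^ p' := by
  have h := Measure.integral_comp_inv_smul_of_nonneg (volume : Measure (Space N))
    (fun x => ‖weightedFracLaplacian N p σ q x‖ ^ p') hR.le
  simp only [finrank_euclideanSpace, Fintype.card_fin, smul_eq_mul] at h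
  have hRσ : 0 ≤ R ^ (-σ) := Real.rpow_nonneg hR.le _
  simp only [Real.mul_rpow hRσ (norm_nonneg _)]
  rw [integral_const_mul, h, ← mul_assoc, ← Real.rpow_mul hR.le, ← Real.rpow_natCast,
    ← Real.rpow_add hR]
  congr 2; ring

/-- Testing the equation at a fixed time with the weight `⟨x/R⟩^{-q}`: half of the nonlinear term
absorbs the fractional Laplacian up to a constant by Young's inequality, and the other half bounds
a power of the weighted average of `u` by Hölder's inequality. -/
theorem weighted_average_ineq {N : ℕ} {p p' σ q C₁ R d : ℝ} (hpp : p.HolderConjugate p')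
    (hC₁ : 0 < C₁) (hq : (N : ℝ) < q) (hR : 0 < R) {f : ℝ → ℝ}
    (hf : ∀ z : ℝ, C₁ * |z| ^ p ≤ f z)
    (hmφ : MemLp (fun ξ => (((2 * Real.pi * ‖ξ‖) ^ σ : ℝ) : ℂ) *
      l2Fourier (fun y : Space N => ((japaneseBracket y ^ (-q) : ℝ) : ℂ)) ξ) 2 volume)
    (hK : MemLp (weightedFracLaplacian N p σ q) (ENNReal.ofReal p') volume)
    {u u' u'' : Space N → ℝ} (hu : MemLp u 2 volume) (hu' : MemLp u' 2 volume)
    (hu'' : MemLp u'' 2 volume)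
    (hmu : MemLp (fun ξ => (((2 * Real.pi * ‖ξ‖) ^ σ : ℝ) : ℂ) *
      l2Fourier (fun x => (u x : ℂ)) ξ) 2 volume)
    (heq : ∀ᵐ x, u'' x + (fracLaplacian σ (fun y => (u y : ℂ)) x).re + d * u' x = f (u x)) :
    C₁ / 2 * (R ^ N * weightL1 N q) ^ (-(p - 1)) * |∫ x, u x * dilatedWeight q R x| ^ p
        - (C₁ / 2 * p) ^ (-(p' / p)) / p' * (R ^ (N - σ * p') *
          ∫ x, ‖weightedFracLaplacian N p σ q x‖ ^ p')
      ≤ (∫ x, u'' x * dilatedWeight q R x) + d * ∫ x, u' x * dilatedWeight q R x := by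
  have hp := hpp.pos
  have hp1 := hpp.lt
  have hp' := hpp.symm.pos
  have hp'1 := hpp.symm.lt
  set φ : Space N → ℝ := dilatedWeight q R with hφ
  have hφ0 : ∀ x, 0 < φ x := dilatedWeight_pos q R
  have hφ2 : MemLp φ 2 volume := memLp_dilatedWeight hq hR
  have hφi : Integrable φ volume := integrable_dilatedWeight hq hR
  have hφL2 := memLp_japaneseBracket_rpow (N := N) hq
  set w : Space N → ℝ := fun x => (fracLaplacian σ (fun y => (u y : ℂ)) x).re with hw
  have hw2 : MemLp w 2 volume := (memLp_fracLaplacian σ (fun y => (u y : ℂ))).re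
  -- The nonlinear term is in `L²` because every other term of the equation is.
  have hfu : Integrable (fun x => f (u x) * φ x) volume := by
    have h1 : MemLp (fun x => u'' x + w x + d * u' x) 2 volume :=
      (hu''.add hw2).add (hu'.const_mul d)
    refine (h1.integrable_mul hφ2).congr ?_
    filter_upwards [heq] with x hx
    simp only [Pi.mul_apply]
    rw [hx]
  have hI : Integrable (fun x => |u x| ^ p * φ x) volume := by
    refine (hfu.const_mul C₁⁻¹).mono' ?_ (Filter.Eventually.of_forall fun x => ?_)
    · refine AEStronglyMeasurable.mul ?_ hφi.aestronglyMeasurable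
      exact ((hu.aestronglyMeasurable.aemeasurable.abs).pow_const p).aestronglyMeasurable
    · rw [Real.norm_of_nonneg (mul_nonneg (by positivity) (hφ0 x).le)]
      have h1 := mul_le_mul_of_nonneg_right (hf (u x)) (hφ0 x).le
      rw [inv_mul_eq_div, le_div_iff₀ hC₁]
      linarith
  -- The fractional Laplacian of the dilated weight.
  have hLφ : fracLaplacian σ (fun x => (φ x : ℂ)) =ᵐ[volume] fun x => ((R ^ (-σ) : ℝ) : ℂ) *
      fracLaplacian σ (fun y : Space N => ((japaneseBracket y ^ (-q) : ℝ) : ℂ)) (R⁻¹ • x) :=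
    fracLaplacian_comp_inv_smul hφL2 hmφ hR
  have hmφR : MemLp (fun ξ => (((2 * Real.pi * ‖ξ‖) ^ σ : ℝ) : ℂ) *
      l2Fourier (fun x => (φ x : ℂ)) ξ) 2 volume := by
    have h1 := l2Fourier_comp_inv_smul hφL2 hR
    have h2 := (hmφ.comp_space_smul hR.ne').const_mul ((R : ℂ) ^ N * ((R ^ (-σ) : ℝ) : ℂ))
    refine h2.ae_eq ?_
    filter_upwards [h1] with ξ h1
    have e : (fun x => (φ x : ℂ)) =
      fun x => ((japaneseBracket (R⁻¹ • x) ^ (-q) : ℝ) : ℂ) := rfl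
    have e2 : (2 * Real.pi * ‖R • ξ‖) ^ σ = R ^ σ * (2 * Real.pi * ‖ξ‖) ^ σ := by
      rw [norm_smul, Real.norm_of_nonneg hR.le, ← Real.mul_rpow hR.le (by positivity)]
      congr 1; ring
    have hne : ((R ^ σ : ℝ) : ℂ) ≠ 0 := by exact_mod_cast (Real.rpow_pos_of_pos hR σ).ne'
    rw [e, h1, e2, Real.rpow_neg hR.le]
    push_cast
    field_simp
  have hdual := abs_integral_re_fracLaplacian_mul_le hu hφ2 hmu hmφR
  set H : Space N → ℝ := fun x => R ^ (-σ) * ‖weightedFracLaplacian N p σ q (R⁻¹ • x)‖ with hH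
  have hRσ : 0 ≤ R ^ (-σ) := Real.rpow_nonneg hR.le _
  have hH0 : ∀ x, 0 ≤ H x := fun x => mul_nonneg hRσ (norm_nonneg _)
  have hHi : Integrable (fun x => H x ^ p') volume := by
    have h1 := hK.integrable_norm_rpow (by simpa using hp') ENNReal.ofReal_ne_top
    rw [ENNReal.toReal_ofReal hp'.le] at h1
    have h2 := ((h1.comp_smul (inv_ne_zero hR.ne')).const_mul ((R ^ (-σ)) ^ p'))
    refine h2.congr (Filter.Eventually.of_forall fun x => ?_)
    simp only [hH]
    rw [Real.mul_rpow hRσ (norm_nonneg _)]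
  have hpt : ∀ᵐ x, |u x| * ‖fracLaplacian σ (fun y => (φ y : ℂ)) x‖ ≤
      C₁ / 2 * (|u x| ^ p * φ x) + (C₁ / 2 * p) ^ (-(p' / p)) / p' * H x ^ p' := by
    filter_upwards [hLφ] with x hx
    have hb := japaneseBracket_pos (R⁻¹ • x)
    have h1 := young_with_weight hpp (δ := C₁ / 2) (by positivity)
      (mul_nonneg (abs_nonneg (u x)) (Real.rpow_nonneg (hφ0 x).le (1 / p))) (hH0 x)
    have e1 : (|u x| * φ x ^ (1 / p)) ^ p = |u x| ^ p * φ x := by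
      rw [Real.mul_rpow (abs_nonneg _) (Real.rpow_nonneg (hφ0 x).le _),
        ← Real.rpow_mul (hφ0 x).le, one_div_mul_cancel hp.ne', Real.rpow_one]
    have e2 : φ x ^ (1 / p) * japaneseBracket (R⁻¹ • x) ^ (q / p) = 1 := by
      simp only [hφ, dilatedWeight]
      rw [← Real.rpow_mul hb.le, ← Real.rpow_add hb, show -q * (1 / p) + q / p = 0 by ring,
        Real.rpow_zero]
    have e3 : |u x| * φ x ^ (1 / p) * H x =
        |u x| * ‖fracLaplacian σ (fun y => (φ y : ℂ)) x‖ := by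
      simp only [hH]
      rw [hx, norm_weightedFracLaplacian, norm_mul, Complex.norm_real, Real.norm_of_nonneg hRσ]
      linear_combination |u x| * R ^ (-σ) * ‖fracLaplacian σ (fun y : Space N =>
        ((japaneseBracket y ^ (-q) : ℝ) : ℂ)) (R⁻¹ • x)‖ * e2
    rwa [e1, e3] at h1
  have hLu : ∫ x, |u x| * ‖fracLaplacian σ (fun y => (φ y : ℂ)) x‖ ≤
      C₁ / 2 * (∫ x, |u x| ^ p * φ x) + (C₁ / 2 * p) ^ (-(p' / p)) / p' * (R ^ (N - σ * p') *
          ∫ x, ‖weightedFracLaplacian N p σ q x‖ ^ p') := by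
    rw [← integral_norm_weightedFracLaplacian_dilated hR, ← integral_const_mul,
      ← integral_const_mul, ← integral_add (hI.const_mul _) (hHi.const_mul _)]
    refine integral_mono_ae ?_ ((hI.const_mul _).add (hHi.const_mul _)) hpt
    exact hu.abs.integrable_mul (memLp_fracLaplacian σ (fun y => (φ y : ℂ))).norm
  have hhol : (R ^ N * weightL1 N q) ^ (-(p - 1)) * |∫ x, u x * φ x| ^ p
      ≤ ∫ x, |u x| ^ p * φ x := by
    have hW : 0 < R ^ N * weightL1 N q := mul_pos (pow_pos hR N) (weightL1_pos hq)
    have h1 := abs_integral_mul_rpow_le hpp hu.aestronglyMeasurable hφ0 hφi hI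
    rw [hφ, integral_dilatedWeight q hR, ← hφ] at h1
    rw [Real.rpow_neg hW.le, inv_mul_le_iff₀ (Real.rpow_pos_of_pos hW _), mul_comm]
    exact h1
  have htest : (∫ x, u'' x * φ x) + d * ∫ x, u' x * φ x
      = (∫ x, f (u x) * φ x) - ∫ x, w x * φ x := by
    have i1 : Integrable (fun x => u'' x * φ x) volume := hu''.integrable_mul hφ2
    have i2 : Integrable (fun x => u' x * φ x) volume := hu'.integrable_mul hφ2
    have i3 : Integrable (fun x => w x * φ x) volume := hw2.integrable_mul hφ2
    rw [← integral_const_mul, ← integral_add i1 (i2.const_mul d), ← integral_sub hfu i3]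
    refine integral_congr_ae ?_
    filter_upwards [heq] with x hx
    rw [← hx]; ring
  have hlow : C₁ * (∫ x, |u x| ^ p * φ x) ≤ ∫ x, f (u x) * φ x := by
    rw [← integral_const_mul]
    refine integral_mono (hI.const_mul _) hfu fun x => ?_
    have := mul_le_mul_of_nonneg_right (hf (u x)) (hφ0 x).le
    simp only
    linarith
  have h5 := (le_abs_self _).trans hdual
  have h6 := mul_le_mul_of_nonneg_left hhol (by positivity : 0 ≤ C₁ / 2)
  rw [htest]
  linarith

/-! ### The constants `A` and `R(ε)` -/

theorem constA_eq (N : ℕ) (p σ q C₁ : ℝ) :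
    constA N p σ q C₁ = (2 / C₁) ^ (p / (p - 1) - 1) * (p / (p - 1)) ^ (-1 / p) *
      p ^ ((1 - p / (p - 1)) / p) *
      (eLpNorm (weightedFracLaplacian N p σ q) (ENNReal.ofReal (p / (p - 1))) volume).toReal
        ^ (p / (p - 1) / p) * weightL1 N q ^ (1 / (p / (p - 1))) := rfl

theorem constA_nonneg {N : ℕ} {p σ q C₁ : ℝ} (hp : 1 < p) (hC₁ : 0 < C₁) (hq : (N : ℝ) < q) :
    0 ≤ constA N p σ q C₁ := by
  have hW := weightL1_pos hq
  have : 0 < p - 1 := by linarith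
  rw [constA_eq]
  positivity

/-- The radius can be positive only when `A ≠ 0`. -/
theorem constA_pos_of_radius {N : ℕ} {p σ q C₁ I₀ ε : ℝ} (hN : 0 < N) (hp : 1 < p)
    (hpc : p < critExponent N σ) (hC₁ : 0 < C₁) (hq : (N : ℝ) < q)
    (h : radius N p σ q C₁ I₀ ε ≠ 0) : 0 < constA N p σ q C₁ := by
  refine (constA_nonneg hp hC₁ hq).lt_of_ne' fun h0 => h ?_
  have hN' : (0 : ℝ) < N := by exact_mod_cast hN
  have hne : -((p - 1) / (N * (p - critExponent N σ))) ≠ 0 := by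
    rw [neg_ne_zero]
    exact div_ne_zero (by linarith) (mul_ne_zero hN'.ne' (by linarith))
  simp only [radius]
  rw [h0, Real.zero_rpow hne, zero_mul]

/-- In the definition of `A` an infinite norm counts as `0`, so `A > 0` says that the norm is
nonzero and finite. -/
theorem norm_pos_of_constA_pos {N : ℕ} {p σ q C₁ : ℝ} (hp : 1 < p)
    (h : 0 < constA N p σ q C₁) :
    0 < (eLpNorm (weightedFracLaplacian N p σ q)
      (ENNReal.ofReal (p / (p - 1))) volume).toReal := by
  refine ENNReal.toReal_nonneg.lt_of_ne' fun h0 => h.ne' ?_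
  have hne : p / (p - 1) / p ≠ 0 :=
    div_ne_zero (div_ne_zero (by linarith) (by linarith)) (by linarith)
  rw [constA_eq, h0, Real.zero_rpow hne]
  ring

theorem memLp_weightedFracLaplacian {N : ℕ} {p σ q C₁ : ℝ} (hp : 1 < p)
    (h : 0 < constA N p σ q C₁) :
    MemLp (weightedFracLaplacian N p σ q) (ENNReal.ofReal (p / (p - 1))) volume :=
  ⟨aestronglyMeasurable_weightedFracLaplacian N p σ q,
    lt_top_iff_ne_top.2 (ENNReal.toReal_pos_iff.1 (norm_pos_of_constA_pos hp h)).2.ne⟩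

/-- If `A > 0` then `(-Δ)^{σ/2} ⟨x⟩^{-q}` is not the zero function, so that `|ξ|^σ` times the
Fourier transform of the weight lies in `L²`: `l2FourierInv` vanishes outside `L²`. -/
theorem memLp_symbol_mul_weight {N : ℕ} {p σ q C₁ : ℝ} (hp : 1 < p)
    (h : 0 < constA N p σ q C₁) :
    MemLp (fun ξ => (((2 * Real.pi * ‖ξ‖) ^ σ : ℝ) : ℂ) *
      l2Fourier (fun y : Space N => ((japaneseBracket y ^ (-q) : ℝ) : ℂ)) ξ) 2 volume := by
  by_contra hcon
  have h0 : weightedFracLaplacian N p σ q = 0 := by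
    funext x
    simp only [weightedFracLaplacian, fracLaplacian, l2FourierInv, dif_neg hcon, Pi.zero_apply,
      zero_mul]
  have := norm_pos_of_constA_pos hp h
  rw [h0, eLpNorm_zero] at this
  simp at this

theorem radius_pos {N : ℕ} {p σ q C₁ I₀ ε : ℝ} (hA : 0 < constA N p σ q C₁) (hI₀ : 0 < I₀)
    (hε : 0 < ε) : 0 < radius N p σ q C₁ I₀ ε := by
  unfold radius
  positivity

/-- `R(ε)` is the radius for which `A R^{N - σ/(p-1)} = ε I₀ / 4`. -/
theorem constA_mul_radius_rpow {N : ℕ} {p σ q C₁ I₀ ε : ℝ} (hN : 0 < N) (hp : 1 < p)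
    (hpc : p < critExponent N σ) (hA : 0 < constA N p σ q C₁) (hI₀ : 0 < I₀) (hε : 0 < ε) :
    constA N p σ q C₁ * radius N p σ q C₁ I₀ ε ^ (N - σ / (p - 1)) = ε / 4 * I₀ := by
  have hN' : (0 : ℝ) < N := by exact_mod_cast hN
  have hx : 0 < ε / 4 * I₀ := by positivity
  set θ := (p - 1) / (N * (p - critExponent N σ)) with hθ
  have hp1 : p - 1 ≠ 0 := by linarith
  have hpc' : p - critExponent N σ ≠ 0 := by linarith
  have e : θ * (N - σ / (p - 1)) = 1 := by
    rw [hθ]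
    have : N - σ / (p - 1) = N * (p - critExponent N σ) / (p - 1) := by
      unfold critExponent; field_simp; ring
    rw [this]
    field_simp
  have er : radius N p σ q C₁ I₀ ε = constA N p σ q C₁ ^ (-θ) * (ε / 4 * I₀) ^ θ := rfl
  rw [er, Real.mul_rpow (by positivity) (by positivity), ← Real.rpow_mul hA.le,
    ← Real.rpow_mul hx.le, neg_mul, e, Real.rpow_neg hA.le, Real.rpow_one, Real.rpow_one]
  field_simp

/-- The constant `A` is the one for which the source term and the error term produced by Young's
inequality balance at the level `A R^{N - σ/(p-1)}` of the weighted average. -/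
theorem young_error_eq {N : ℕ} {p p' σ q C₁ R : ℝ} (hpp : p.HolderConjugate p') (hC₁ : 0 < C₁)
    (hq : (N : ℝ) < q) (hR : 0 < R) (hA : 0 < constA N p σ q C₁) :
    (C₁ / 2 * p) ^ (-(p' / p)) / p' * (R ^ (N - σ * p') *
        ∫ x, ‖weightedFracLaplacian N p σ q x‖ ^ p')
      = C₁ / 2 * (R ^ N * weightL1 N q) ^ (-(p - 1)) *
        (constA N p σ q C₁ * R ^ (N - σ / (p - 1))) ^ p := by
  have hp := hpp.pos
  have hp1 := hpp.lt
  have hp' := hpp.symm.pos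
  have hp0 : 0 < p - 1 := by linarith
  have hW := weightL1_pos hq
  have ep' : p / (p - 1) = p' := hpp.conjugate_eq.symm
  have hK := norm_pos_of_constA_pos hp1 hA
  have hKm := memLp_weightedFracLaplacian hp1 hA
  rw [constA_eq, ep']
  rw [ep'] at hK hKm
  have eK : ∫ x, ‖weightedFracLaplacian N p σ q x‖ ^ p' =
      (eLpNorm (weightedFracLaplacian N p σ q) (ENNReal.ofReal p') volume).toReal ^ p' := by
    have h0 : 0 ≤ ∫ x, ‖weightedFracLaplacian N p σ q x‖ ^ p' :=
      integral_nonneg fun x => by positivity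
    rw [hKm.eLpNorm_eq_integral_rpow_norm (by simpa using hp') ENNReal.ofReal_ne_top,
      ENNReal.toReal_ofReal hp'.le, ENNReal.toReal_ofReal (by positivity),
      ← Real.rpow_mul h0, inv_mul_cancel₀ hp'.ne', Real.rpow_one]
  rw [eK]
  set K := (eLpNorm (weightedFracLaplacian N p σ q) (ENNReal.ofReal p') volume).toReal
  set W := weightL1 N q
  have e1 : (p' - 1) * p = p' := by rw [← ep']; field_simp; ring
  have e2 : p' / p = p' - 1 := by rw [div_eq_iff hp.ne', e1]
  have e3 : 1 / p' * p = p - 1 := by rw [one_div_mul_eq_div, hpp.div_conj_eq_sub_one]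
  have h2C : 2 / C₁ = (C₁ / 2)⁻¹ := by rw [inv_div]
  have hc : 0 < C₁ / 2 := by positivity
  have t1 : ((2 / C₁) ^ (p' - 1)) ^ p = (C₁ / 2) ^ (-p') := by
    rw [← Real.rpow_mul (by positivity), e1, h2C, Real.inv_rpow hc.le, Real.rpow_neg hc.le]
  have t2 : (p' ^ (-1 / p)) ^ p = p'⁻¹ := by
    rw [← Real.rpow_mul hp'.le, div_mul_cancel₀ _ hp.ne', Real.rpow_neg_one]
  have t3 : (p ^ ((1 - p') / p)) ^ p = p ^ (1 - p') := by
    rw [← Real.rpow_mul hp.le, div_mul_cancel₀ _ hp.ne']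
  have t4 : (K ^ (p' / p)) ^ p = K ^ p' := by
    rw [← Real.rpow_mul hK.le, div_mul_cancel₀ _ hp.ne']
  have t5 : (W ^ (1 / p')) ^ p = W ^ (p - 1) := by rw [← Real.rpow_mul hW.le, e3]
  have t6 : (R ^ (N - σ / (p - 1))) ^ p = R ^ (N - σ * p') * R ^ ((N : ℝ) * (p - 1)) := by
    rw [← Real.rpow_mul hR.le, ← Real.rpow_add hR]
    congr 1
    rw [← ep']; field_simp; ring
  have t7 : (R ^ N * W) ^ (-(p - 1)) = (R ^ ((N : ℝ) * (p - 1)))⁻¹ * (W ^ (p - 1))⁻¹ := by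
    rw [Real.mul_rpow (by positivity) hW.le, Real.rpow_neg hW.le, Real.rpow_neg (by positivity),
      ← Real.rpow_natCast, ← Real.rpow_mul hR.le]
  have t8 : (C₁ / 2 * p) ^ (-(p' / p)) = C₁ / 2 * (C₁ / 2) ^ (-p') * p ^ (1 - p') := by
    rw [e2, Real.mul_rpow hc.le hp.le, neg_sub]
    congr 1
    nth_rewrite 2 [← Real.rpow_one (C₁ / 2)]
    rw [← Real.rpow_add hc]
    congr 1
  have hRn : R ^ ((N : ℝ) * (p - 1)) ≠ 0 := (Real.rpow_pos_of_pos hR _).ne'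
  have hWn : W ^ (p - 1) ≠ 0 := (Real.rpow_pos_of_pos hW _).ne'
  rw [t8, t7, Real.mul_rpow (by positivity) (by positivity),
    Real.mul_rpow (by positivity) (by positivity),
    Real.mul_rpow (by positivity) (by positivity), Real.mul_rpow (by positivity) (by positivity),
    Real.mul_rpow (by positivity) (by positivity), t1, t2, t3, t4, t5, t6]
  field_simp

/-- The source strength in the normalized inequality for the weighted average. -/
noncomputable def sourceStrength (N : ℕ) (p σ q C₁ I₀ ε : ℝ) : ℝ :=
  C₁ / 2 * (radius N p σ q C₁ I₀ ε ^ N * weightL1 N q) ^ (-(p - 1)) * (ε * I₀ / 2) ^ (p - 1) / 2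

theorem sourceStrength_pos {N : ℕ} {p σ q C₁ I₀ ε : ℝ} (hC₁ : 0 < C₁) (hq : (N : ℝ) < q)
    (hA : 0 < constA N p σ q C₁) (hI₀ : 0 < I₀) (hε : 0 < ε) :
    0 < sourceStrength N p σ q C₁ I₀ ε := by
  have hR := radius_pos hA hI₀ hε
  have hW := weightL1_pos hq
  unfold sourceStrength
  positivity

theorem sourceStrength_le_one {N : ℕ} {p σ q C₁ I₀ ε : ℝ} (hp : 1 < p) (hC₁ : 0 < C₁)
    (hq : (N : ℝ) < q) (hA : 0 < constA N p σ q C₁) (hI₀ : 0 < I₀) (hε : 0 < ε)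
    (hs : ε * I₀ ≤ (C₁ / 2) ^ (-1 / (p - 1)) * weightL1 N q * radius N p σ q C₁ I₀ ε ^ N) :
    sourceStrength N p σ q C₁ I₀ ε ≤ 1 := by
  have hR := radius_pos hA hI₀ hε
  have hW := weightL1_pos hq
  have hp1 : 0 < p - 1 := by linarith
  have hc : 0 < C₁ / 2 := by positivity
  set X := radius N p σ q C₁ I₀ ε ^ N * weightL1 N q with hX
  have hX0 : 0 < X := by positivity
  have h1 : (ε * I₀ / 2) ^ (p - 1) ≤ (C₁ / 2)⁻¹ * X ^ (p - 1) := by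
    have h2 : ε * I₀ / 2 ≤ (C₁ / 2) ^ (-1 / (p - 1)) * X := by
      have : 0 < ε * I₀ := by positivity
      rw [hX]; linarith
    refine (Real.rpow_le_rpow (by positivity) h2 hp1.le).trans_eq ?_
    rw [Real.mul_rpow (by positivity) hX0.le, ← Real.rpow_mul hc.le,
      div_mul_cancel₀ _ hp1.ne', Real.rpow_neg_one]
  have hXp : 0 < X ^ (p - 1) := by positivity
  have h3 : C₁ / 2 * X ^ (-(p - 1)) * (ε * I₀ / 2) ^ (p - 1) ≤ 1 := by
    calc _ ≤ C₁ / 2 * X ^ (-(p - 1)) * ((C₁ / 2)⁻¹ * X ^ (p - 1)) := by gcongr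
      _ = 1 := by
        rw [Real.rpow_neg hX0.le]
        field_simp
  unfold sourceStrength
  rw [← hX]
  linarith

theorem sourceStrength_eq {N : ℕ} {p σ q C₁ I₀ ε : ℝ} (hN : 0 < N) (hσ : 0 < σ) (hp : 1 < p)
    (hpc : p < critExponent N σ) (hq : (N : ℝ) < q)
    (hA : 0 < constA N p σ q C₁) (hI₀ : 0 < I₀) (hε : 0 < ε) :
    sourceStrength N p σ q C₁ I₀ ε
      = sourceStrength N p σ q C₁ I₀ 1 * ε ^ (1 / (1 / (p - 1) - N / σ)) := by
  have hN' : (0 : ℝ) < N := by exact_mod_cast hN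
  have hW := weightL1_pos hq
  have hp1 : p - 1 ≠ 0 := by linarith
  set θ := (p - 1) / (N * (p - critExponent N σ)) with hθ
  have hR1 := radius_pos hA hI₀ one_pos
  have eR : radius N p σ q C₁ I₀ ε = radius N p σ q C₁ I₀ 1 * ε ^ θ := by
    simp only [radius]
    rw [← hθ, show ε / 4 * I₀ = 1 / 4 * I₀ * ε by ring,
      Real.mul_rpow (by positivity) hε.le, mul_assoc]
  have e1 : (radius N p σ q C₁ I₀ ε ^ N * weightL1 N q) ^ (-(p - 1))
      = (radius N p σ q C₁ I₀ 1 ^ N * weightL1 N q) ^ (-(p - 1)) * ε ^ (θ * N * (-(p - 1))) := by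
    rw [eR, mul_pow, mul_right_comm, Real.mul_rpow (by positivity) (by positivity),
      ← Real.rpow_natCast (ε ^ θ), ← Real.rpow_mul hε.le, ← Real.rpow_mul hε.le]
  have e2 : (ε * I₀ / 2) ^ (p - 1) = (1 * I₀ / 2) ^ (p - 1) * ε ^ (p - 1) := by
    rw [← Real.mul_rpow (by positivity) hε.le]
    congr 1; ring
  have hd : p - critExponent N σ ≠ 0 := by linarith
  have hd2 : σ - N * (p - 1) ≠ 0 := by
    unfold critExponent at hpc
    have := mul_lt_mul_of_pos_left hpc hN'
    rw [mul_add, mul_div_cancel₀ _ hN'.ne'] at this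
    intro h; linarith
  have e3 : θ * N * (-(p - 1)) + (p - 1) = 1 / (1 / (p - 1) - N / σ) := by
    have k1 : 1 / (p - 1) - N / σ = (σ - N * (p - 1)) / ((p - 1) * σ) := by
      field_simp
    have k2 : θ = -((p - 1) / (σ - N * (p - 1))) := by
      rw [hθ, ← div_neg]
      congr 1
      unfold critExponent; field_simp; ring
    have k3 : (p - 1) / (σ - N * (p - 1)) * (σ - N * (p - 1)) = p - 1 := div_mul_cancel₀ _ hd2
    rw [k1, k2, one_div_div, eq_div_iff hd2]
    linear_combination N * (p - 1) * k3
  unfold sourceStrength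
  rw [e1, e2, ← e3, Real.rpow_add hε]
  ring

/-! ### Strong solutions -/

theorem IsStrongSolution.memLp_symbol_mul {N : ℕ} {σ T : ℝ} {b f : ℝ → ℝ} {u₀ u₁ : Space N → ℝ}
    {u : ℝ → Lp ℝ 2 (volume : Measure (Space N))} (hσ : 0 < σ)
    (hu : IsStrongSolution σ b f u₀ u₁ T u) {t : ℝ} (ht : t ∈ Ico 0 T) :
    MemLp (fun ξ => (((2 * Real.pi * ‖ξ‖) ^ σ : ℝ) : ℂ) *
      l2Fourier (fun x => ((u t x : ℝ) : ℂ)) ξ) 2 volume := by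
  obtain ⟨v, -, hv⟩ := hu.c0_Hs
  have h1 := (Lp.memLp (v t)).ae_eq (hv t ht)
  refine h1.mono ?_ (Filter.Eventually.of_forall fun ξ => ?_)
  · refine AEStronglyMeasurable.mul ?_ (memLp_l2Fourier _).aestronglyMeasurable
    have : Continuous fun ξ : Space N => (2 * Real.pi * ‖ξ‖) ^ σ :=
      (by fun_prop : Continuous fun ξ : Space N => 2 * Real.pi * ‖ξ‖).rpow_const
        fun _ => Or.inr hσ.le
    exact (Complex.continuous_ofReal.comp this).aestronglyMeasurable
  · have h2 : (2 * Real.pi * ‖ξ‖) ^ σ ≤ japaneseBracket ((2 * Real.pi) • ξ) ^ σ := by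
      refine Real.rpow_le_rpow (by positivity) ?_ hσ.le
      unfold japaneseBracket
      refine Real.le_sqrt_of_sq_le ?_
      rw [norm_smul, Real.norm_of_nonneg (by positivity)]
      linarith
    have h3 : 0 ≤ (2 * Real.pi * ‖ξ‖) ^ σ := by positivity
    rw [norm_mul, norm_mul, Complex.norm_real, Complex.norm_real, Real.norm_of_nonneg h3,
      Real.norm_of_nonneg (h3.trans h2)]
    gcongr

theorem hasDerivWithinAt_of_contDiffOn_two {E : Type*} [NormedAddCommGroup E] [NormedSpace ℝ E]
    {T : ℝ} {u : ℝ → E} (hu : ContDiffOn ℝ 2 u (Ico 0 T)) {t : ℝ} (ht : t ∈ Ico 0 T) :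
    HasDerivWithinAt u (derivWithin u (Ico 0 T) t) (Ico 0 T) t ∧
    HasDerivWithinAt (derivWithin u (Ico 0 T)) (iteratedDerivWithin 2 u (Ico 0 T) t)
      (Ico 0 T) t := by
  have hU : UniqueDiffOn ℝ (Ico (0 : ℝ) T) := uniqueDiffOn_Ico 0 T
  refine ⟨((hu.differentiableOn (by norm_num)) t ht).hasDerivWithinAt, ?_⟩
  have h1 := ((hu.differentiableOn_iteratedDerivWithin (m := 1) (by norm_num) hU)
    t ht).hasDerivWithinAt
  have e : iteratedDerivWithin 1 u (Ico 0 T) = derivWithin u (Ico 0 T) := by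
    funext s
    rw [iteratedDerivWithin_one]
  rw [e] at h1
  rwa [iteratedDerivWithin_succ, e]

theorem weightedIntegral_le_integral_abs {N : ℕ} {q R : ℝ} (hq : 0 ≤ q) {a : Space N → ℝ}
    (ha : Integrable a volume) : weightedIntegral q R a ≤ ∫ x, |a x| := by
  unfold weightedIntegral
  refine (le_abs_self _).trans (abs_integral_le_integral_abs.trans ?_)
  refine integral_mono_of_nonneg (Filter.Eventually.of_forall fun x => abs_nonneg _) ha.abs
    (Filter.Eventually.of_forall fun x => ?_)
  have h1 := dilatedWeight_le_one hq R x
  have h2 := dilatedWeight_pos q R x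
  simp only [abs_mul]
  rw [abs_of_pos (show 0 < japaneseBracket (R⁻¹ • x) ^ (-q) from h2)]
  exact mul_le_of_le_one_left (abs_nonneg _) h1

/-- The weighted average of a strong solution, divided by the lower bound `ε I₀ / 2` of its initial
value, satisfies the differential inequality for which blow-up is known. -/
theorem IsStrongSolution.isDampedSupersolution {N : ℕ} {σ β p q C₁ b₂ ε T : ℝ}
    (hN : 0 < N) (hσ : 0 < σ) (hp : 1 < p) (hpc : p < critExponent N σ) (hq : (N : ℝ) < q)
    {b f : ℝ → ℝ} (hb : ∀ t, 0 ≤ t → 0 < b t) (hb' : ∀ t, 0 ≤ t → b t ≤ b₂ * (1 + t) ^ (-β))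
    (hC₁ : 0 < C₁) (hf : ∀ z : ℝ, C₁ * |z| ^ p ≤ f z) {a₀ a₁ : Space N → ℝ}
    (ha₀ : Integrable a₀ volume) (hI₀ : 0 < ∫ x, a₀ x)
    (hA : 0 < constA N p σ q C₁) (hε : 0 < ε) (hT : 0 < T)
    (hs : SmallnessConditions p σ q C₁ a₀ a₁ ε)
    {u : ℝ → Lp ℝ 2 (volume : Measure (Space N))}
    (hu : IsStrongSolution σ b f (fun x => ε * a₀ x) (fun x => ε * a₁ x) T u) :
    ∃ y y' y'' : ℝ → ℝ, IsDampedSupersolution p β b₂ (2 * (∫ x, |a₀ x|) / ∫ x, a₀ x)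
      ((∫ x, a₁ x) / ∫ x, a₀ x) (sourceStrength N p σ q C₁ (∫ x, a₀ x) ε) T b y y' y'' := by
  set I₀ := ∫ x, a₀ x with hI₀def
  set R := radius N p σ q C₁ I₀ ε with hR
  have hR0 : 0 < R := radius_pos hA hI₀ hε
  have hφ2 : MemLp (dilatedWeight q R : Space N → ℝ) 2 volume := memLp_dilatedWeight hq hR0
  have hq0 : 0 ≤ q := N.cast_nonneg.trans hq.le
  have hpp : p.HolderConjugate (p / (p - 1)) := Real.HolderConjugate.conjExponent hp
  set ℓ : Lp ℝ 2 (volume : Measure (Space N)) →L[ℝ] ℝ := innerSL ℝ (hφ2.toLp _) with hℓ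
  have hℓ_apply : ∀ v : Lp ℝ 2 (volume : Measure (Space N)),
      ℓ v = ∫ x, v x * dilatedWeight q R x := by
    intro v
    rw [hℓ, innerSL_apply_apply, L2.inner_def]
    refine integral_congr_ae ?_
    filter_upwards [hφ2.coeFn_toLp] with x hx
    rw [hx]
    simp
  have hw : ∀ (v : Lp ℝ 2 (volume : Measure (Space N))) (a : Space N → ℝ),
      (v : Space N → ℝ) =ᵐ[volume] (fun x => ε * a x) → ℓ v = ε * weightedIntegral q R a := by
    intro v a hv
    rw [hℓ_apply, weightedIntegral, ← integral_const_mul]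
    refine integral_congr_ae ?_
    filter_upwards [hv] with x hx
    rw [hx, dilatedWeight]; ring
  set m := ε * I₀ / 2 with hm
  have hm0 : 0 < m := by positivity
  have h00 : (0 : ℝ) ∈ Ico 0 T := ⟨le_rfl, hT⟩
  have hder := fun t (ht : t ∈ Ico 0 T) => hasDerivWithinAt_of_contDiffOn_two hu.contDiff_L2 ht
  refine ⟨fun t => ℓ (u t) / m, fun t => ℓ (derivWithin u (Ico 0 T) t) / m,
    fun t => ℓ (iteratedDerivWithin 2 u (Ico 0 T) t) / m, ?_, ?_, ?_, ?_, ?_, ?_, ?_, ?_⟩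
  · exact fun t ht => (ℓ.hasFDerivAt.comp_hasDerivWithinAt t (hder t ht).1).div_const m
  · exact fun t ht => (ℓ.hasFDerivAt.comp_hasDerivWithinAt t (hder t ht).2).div_const m
  · exact fun t ht => hb t ht.1
  · exact fun t ht => hb' t ht.1
  · rw [hw _ _ hu.initial_value, le_div_iff₀ hm0, hm]
    have := mul_le_mul_of_nonneg_left hs.average_a₀ hε.le
    linarith
  · rw [hw _ _ hu.initial_value, div_le_div_iff₀ hm0 hI₀, hm]
    have := weightedIntegral_le_integral_abs (R := R) hq0 ha₀
    have h2 := mul_le_mul_of_nonneg_left this (mul_pos hε hI₀).le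
    linarith
  · rw [hw _ _ hu.initial_velocity, div_le_div_iff₀ hI₀ hm0, hm]
    have h2 := mul_le_mul_of_nonneg_left hs.average_a₁ (mul_pos hε hI₀).le
    linarith
  · intro t ht hy
    have heq : ∀ᵐ x, iteratedDerivWithin 2 u (Ico 0 T) t x
        + (fracLaplacian σ (fun y => ((u t y : ℝ) : ℂ)) x).re
        + b t * derivWithin u (Ico 0 T) t x = f (u t x) := by
      filter_upwards [hu.equation t ht] with x hx
      have := congrArg Complex.re hx
      simpa only [Complex.add_re, Complex.ofReal_re] using this
    have key := weighted_average_ineq hpp hC₁ hq hR0 hf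
      (memLp_symbol_mul_weight hp hA) (memLp_weightedFracLaplacian hp hA)
      (Lp.memLp (u t)) (Lp.memLp (derivWithin u (Ico 0 T) t))
      (Lp.memLp (iteratedDerivWithin 2 u (Ico 0 T) t)) (hu.memLp_symbol_mul hσ ht) heq
    rw [young_error_eq hpp hC₁ hq hR0 hA, hR, constA_mul_radius_rpow hN hp hpc hA hI₀ hε, ← hR,
      ← hℓ_apply, ← hℓ_apply, ← hℓ_apply] at key
    set B := C₁ / 2 * (R ^ N * weightL1 N q) ^ (-(p - 1)) with hB
    have hB0 : 0 < B := by
      have := weightL1_pos hq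
      positivity
    set Y := ℓ (u t) / m with hY
    have hY0 : 0 < Y := by linarith
    have eM : ℓ (u t) = m * Y := by rw [hY]; field_simp
    -- The threshold `ε I₀ / 4` is half of `m`, so for `Y ≥ 1` it costs at most half of the source.
    have e1 : (ε / 4 * I₀) ^ p ≤ m ^ p * Y ^ p / 2 := by
      have : ε / 4 * I₀ = m * 2⁻¹ := by rw [hm]; ring
      rw [this, Real.mul_rpow hm0.le (by norm_num), mul_div_assoc]
      refine mul_le_mul_of_nonneg_left ?_ (by positivity)
      have k1 : (2⁻¹ : ℝ) ^ p ≤ 2⁻¹ := by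
        have := Real.rpow_le_rpow_of_exponent_ge (by norm_num : (0 : ℝ) < 2⁻¹) (by norm_num) hp.le
        rwa [Real.rpow_one] at this
      have k2 : 1 ≤ Y ^ p := Real.one_le_rpow hy (by linarith)
      linarith
    rw [eM, abs_of_pos (by positivity), Real.mul_rpow hm0.le hY0.le] at key
    have e2 : m ^ p = m ^ (p - 1) * m := by
      nth_rewrite 3 [← Real.rpow_one m]
      rw [← Real.rpow_add hm0]; congr 1; ring
    have e3 := mul_le_mul_of_nonneg_left e1 hB0.le
    have e4 : sourceStrength N p σ q C₁ I₀ ε * Y ^ p * m = B * (m ^ p * Y ^ p) / 2 := by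
      rw [sourceStrength, ← hR, ← hm, ← hB, e2]; ring
    rw [← mul_div_assoc, ← add_div, le_div_iff₀ hm0, e4]
    linarith

theorem theorem1p2 (N : ℕ) (hN : 0 < N) (σ β p q C₁ ε₀ : ℝ)
    (hσ₀ : 0 < σ) (hσ₂ : σ < 2) (hβ₀ : -1 ≤ β) (hβ₁ : β ≤ 1)
    (hp₁ : 1 < p) (hpc : p < critExponent N σ)
    (hq₀ : (N : ℝ) < q) (hq₁ : q < N + p * σ)
    (b : ℝ → ℝ) (hb : IsDampingCoefficient β b)
    (f : ℝ → ℝ) (hf : IsPowerNonlinearity p f)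
    (hC₁ : 0 < C₁) (hf₁ : ∀ z : ℝ, C₁ * |z| ^ p ≤ f z)
    (a₀ a₁ : Space N → ℝ)
    (ha₀ : MemHs (σ / 2) a₀) (ha₀' : Integrable a₀ volume)
    (ha₁ : MemLp a₁ 2 volume) (ha₁' : Integrable a₁ volume)
    (hI₀ : 0 < ∫ x, a₀ x) (hI₁ : 0 < ∫ x, a₁ x)
    (hε₀ : 0 < ε₀)
    (hsmall : ∀ ε : ℝ, 0 < ε → ε ≤ ε₀ → SmallnessConditions p σ q C₁ a₀ a₁ ε) :
    ∃ C : ℝ, 0 < C ∧ ∀ ε : ℝ, 0 < ε → ε ≤ ε₀ →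
      (-1 < β →
        lifespan σ b f (fun x => ε * a₀ x) (fun x => ε * a₁ x) ≤
          ENNReal.ofReal (C * ε ^ (-(1 / ((1 / (p - 1) - N / σ) * (1 + β)))))) ∧
      (β = -1 →
        lifespan σ b f (fun x => ε * a₀ x) (fun x => ε * a₁ x) ≤
          ENNReal.ofReal (Real.exp (C * ε ^ (-(1 / (1 / (p - 1) - N / σ)))))) := by
  obtain ⟨-, b₁, b₂, b₃, -, hb₂, -, hbb⟩ := hb
  set I₀ := ∫ x, a₀ x with hI₀def
  -- The third smallness condition forces the radius, hence `A`, to be nonzero.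
  have hA : 0 < constA N p σ q C₁ := by
    refine constA_pos_of_radius (I₀ := I₀) (ε := ε₀) hN hp₁ hpc hC₁ hq₀ fun h0 => ?_
    have h1 := (hsmall ε₀ hε₀ le_rfl).small
    rw [← hI₀def, h0, zero_pow hN.ne', mul_zero] at h1
    exact absurd h1 (not_le.2 (mul_pos hε₀ hI₀))
  have hY : 0 < 2 * (∫ x, |a₀ x|) / I₀ := by
    have : I₀ ≤ ∫ x, |a₀ x| := (le_abs_self _).trans abs_integral_le_integral_abs
    have : 0 < ∫ x, |a₀ x| := hI₀.trans_le this
    positivity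
  obtain ⟨C, hC, hbound⟩ := exists_lifespan_bound hp₁ hβ₀ hβ₁ hb₂ (div_pos hI₁ hI₀) hY
  set c := sourceStrength N p σ q C₁ I₀ 1 with hc
  have hc0 : 0 < c := sourceStrength_pos hC₁ hq₀ hA hI₀ one_pos
  have hc1 : 0 < c ^ (-(1 / (1 + β))) := Real.rpow_pos_of_pos hc0 _
  have hci : 0 < c⁻¹ := inv_pos.2 hc0
  refine ⟨C * (c ^ (-(1 / (1 + β))) + c⁻¹), by positivity, fun ε hε hεε => ?_⟩
  have hs := hsmall ε hε hεε
  have hlam := sourceStrength_pos hC₁ hq₀ hA hI₀ hε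
  have hlam1 := sourceStrength_le_one hp₁ hC₁ hq₀ hA hI₀ hε hs.small
  have hlameq := sourceStrength_eq hN hσ₀ hp₁ hpc hq₀ hA hI₀ hε
  have hεp : ∀ s : ℝ, 0 < ε ^ s := fun s => Real.rpow_pos_of_pos hε s
  have hmain : ∀ T : ℝ, 0 < T → ∀ u : ℝ → Lp ℝ 2 (volume : Measure (Space N)),
      IsStrongSolution σ b f (fun x => ε * a₀ x) (fun x => ε * a₁ x) T u →
      (-1 < β → T ≤ C * sourceStrength N p σ q C₁ I₀ ε ^ (-(1 / (1 + β)))) ∧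
      (β = -1 → T ≤ Real.exp (C * (sourceStrength N p σ q C₁ I₀ ε)⁻¹)) := by
    intro T hT u hu
    obtain ⟨y, y', y'', h⟩ := hu.isDampedSupersolution hN hσ₀ hp₁ hpc hq₀
      (fun t ht => (hbb t ht).1) (fun t ht => (hbb t ht).2.2.1) hC₁ hf₁ ha₀' hI₀ hA hε hT hs
    exact hbound _ T hlam hlam1 hT b y y' y'' h
  constructor
  · intro hβ
    refine sSup_le ?_
    rintro τ ⟨T, hT, rfl, u, hu⟩
    refine ENNReal.ofReal_le_ofReal (((hmain T hT u hu).1 hβ).trans ?_)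
    rw [hlameq, Real.mul_rpow hc0.le (hεp _).le, ← Real.rpow_mul hε.le, ← mul_assoc,
      show 1 / (1 / (p - 1) - N / σ) * -(1 / (1 + β))
        = -(1 / ((1 / (p - 1) - N / σ) * (1 + β))) by rw [mul_neg, one_div_mul_one_div]]
    refine mul_le_mul_of_nonneg_right (mul_le_mul_of_nonneg_left ?_ hC.le) (hεp _).le
    linarith
  · intro hβ
    refine sSup_le ?_
    rintro τ ⟨T, hT, rfl, u, hu⟩
    refine ENNReal.ofReal_le_ofReal (((hmain T hT u hu).2 hβ).trans (Real.exp_le_exp.2 ?_))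
    rw [hlameq, mul_inv, ← Real.rpow_neg hε.le, ← mul_assoc]
    refine mul_le_mul_of_nonneg_right (mul_le_mul_of_nonneg_left ?_ hC.le) (hεp _).le
    linarith
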